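/- **Model.** Let $f_0,f_1$ be probability densities on $\mathbb R$, $0<\rho<1$, $0\le\pi<1$, let $(p_i)_{i\ge 0}$ be a probability mass function on $\{0,1,2,\dots\}$, and let $C,N\in\{0,1,2,\dots\}$. The change point $\Lambda$ satisfies $P(\Lambda=0)=\pi$ and $P(\Lambda=\lambda)=(1-\pi)\rho(1-\rho)^{\lambda-1}$ for $\lambda\ge 1$. Given $\Lambda=\lambda$, the variables $X_1,X_2,\dots$ and $\nu_1,\nu_2,\dots$ are all independent, $X_k$ has density $f_0$ for $k<\lambda$ and $f_1$ for $k\ge\lambda$, and $\nu_k$ has mass function $(p_i)$. Write $P_\lambda^\nu,\mathbb E_\lambda^\nu$ for probability and expectation given $\Lambda=\lambda$, and $P_\pi^\nu,\mathbb E_\pi^\nu$ for the unconditional ones. A sampling strategy $\mu=(\mu_k)_{k\ge1}$, $\mu_k\in\{0,1\}$, yields the observations $Z_k=X_k$ if $\mu_k=1$ and $Z_k=\phi$ (blank) if $\mu_k=0$. The number of sampling rights is $N_0=N$, $N_k=\min\{C,N_{k-1}+\nu_k-\mu_k\}$. The strategy is admissible ($\mu\in\mathcal U$) if $\mu_k$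 is a measurable function of $(Z_1^{k-1},\nu_1^k,\mu_1^{k-1})$ and $N_k\ge 0$ for all $k\ge1$. Let $\mathcal F_k=\sigma(Z_1,\dots,Z_k)$ ($\mathcal F_0$ trivial), let $\mathcal T$ be the set of $(\mathcal F_k)$-stopping times with values in $\{0,1,\dots,\infty\}$, and let $\pi_k=P_\pi^\nu(\Lambda\le k\mid\mathcal F_k)$, so that $\pi_0=\pi$. Put $\mathrm{ADD}(\tau,\mu)=\mathbb E_\pi^\nu[(\tau-\Lambda)^+]$ and $\mathrm{PFA}(\tau,\mu)=P_\pi^\nu(\tau<\Lambda)$. The greedy strategy is $\tilde\mu^*_k=1$ if $N_{k-1}+\nu_k\ge1$ and $\tilde\mu^*_k=0$ if $N_{k-1}+\nu_k=0$; the threshold rule, for $0<\alpha<1$, is $\tilde\tau^*=\inf\{k\ge0:\pi_k\ge1-\alpha\}$, with $\pi_k$ computed under $\tilde\mu^*$. Let $\tilde p=\lim_{k\to\infty}\mathbb E[\tilde\mu^*_k]$, let $D(f_1\|f_0)$ be the Kullback–Leibler divergence, assumed finite, and let $l(Z_k)=\log\frac{f_1(X_k)}{f_0(X_k)}$ if $\mu_k=1$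 and $l(Z_k)=0$ if $\mu_k=0$. Under $\tilde\mu^*$ put, for $\varepsilon>0$ and $\lambda\ge1$, $$T_\varepsilon^{(\lambda)}=\sup\Big\{n\ge1:\Big|\frac1n\sum_{i=\lambda}^{\lambda+n-1}l(Z_i)-\tilde p\,D(f_1\|f_0)\Big|>\varepsilon\Big\},\qquad\sup\emptyset=0.$$ **Theorem.** Suppose that for all $\varepsilon>0$ $$\mathbb E_\lambda^\nu[T_\varepsilon^{(\lambda)}]<\infty\ \text{ for all }\lambda\ge1\qquad\text{and}\qquad\sum_{\lambda=1}^\infty\mathbb E_\lambda^\nu[T_\varepsilon^{(\lambda)}]\,P(\Lambda=\lambda)<\infty .$$ Then the limit $\tilde p$ exists, and $(\tilde\tau^*,\tilde\mu^*)$ is first-order asymptotically optimal as $\alpha\to0$: $\tilde\mu^*\in\mathcal U$; $\tilde\tau^*\in\mathcal T$ and $\mathrm{PFA}(\tilde\tau^*,\tilde\mu^*)\le\alpha$ for every $\alpha\in(0,1)$; and, as $\alpha\to0$, $$\mathrm{ADD}(\tilde\tau^*,\tilde\mu^*)=\frac{|\log\alpha|}{\tilde p\,D(f_1\|f_0)+|\log(1-\rho)|}\,(1+o(1))=(1+o(1))\inf\big\{\mathrm{ADD}(\tau,\mu):\mu\in\mathcal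 U,\ \tau\in\mathcal T,\ \mathrm{PFA}(\tau,\mu)\le\alpha\big\}.$$ -/

import Mathlib

open MeasureTheory Filter Topology
open scoped ENNReal

noncomputable section

/-- The data of the Bayesian quickest change-point problem with randomly replenished sampling
rights: pre- and post-change densities `f0`, `f1`; the parameter `ρ` of the geometric prior and the
prior mass `π₀` of `Λ = 0`; the common law `p` of the i.i.d. replenishments `ν_k`; the capacity `C`
and the initial number `N` of sampling rights. -/
structure ChangeModel where
  f0 : ℝ → ℝ
  f1 : ℝ → ℝ
  measurable_f0 : Measurable f0
  measurable_f1 : Measurable f1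
  f0_nonneg : ∀ x, 0 ≤ f0 x
  f1_nonneg : ∀ x, 0 ≤ f1 x
  lintegral_f0 : ∫⁻ x, ENNReal.ofReal (f0 x) = 1
  lintegral_f1 : ∫⁻ x, ENNReal.ofReal (f1 x) = 1
  ρ : ℝ
  ρ_pos : 0 < ρ
  ρ_lt_one : ρ < 1
  π₀ : ℝ
  π₀_nonneg : 0 ≤ π₀
  π₀_lt_one : π₀ < 1
  p : PMF ℕ
  C : ℕ
  N : ℕ

namespace ChangeModel

/-- Sample points `(λ, x, n)`: the change point, the values `x k` of `X_k` and the replenishments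
`n k` in slot `k`. Time slots are `k = 1, 2, …`; the coordinates with index `0` play no role. -/
abbrev Path : Type := ℕ × (ℕ → ℝ) × (ℕ → ℕ)

/-- The change point `Λ`. -/
def Lam (ω : Path) : ℕ := ω.1

/-- The random variable `X_k`. -/
def X (k : ℕ) (ω : Path) : ℝ := ω.2.1 k

/-- The number `ν_k` of sampling rights collected in slot `k`. -/
def nu (k : ℕ) (ω : Path) : ℕ := ω.2.2 k

variable (M : ChangeModel)

/-- The law with density `f0`. -/
def law0 : Measure ℝ := volume.withDensity fun x => ENNReal.ofReal (M.f0 x)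

/-- The law with density `f1`. -/
def law1 : Measure ℝ := volume.withDensity fun x => ENNReal.ofReal (M.f1 x)

/-- The prior probability `P(Λ = j)`. -/
def prior (j : ℕ) : ℝ :=
  if j = 0 then M.π₀ else (1 - M.π₀) * M.ρ * (1 - M.ρ) ^ (j - 1)

/-- `P_λ^ν`: given `Λ = j`, the `X_k` and `ν_k` are all independent, `X_k` has density `f0` for
`k < j` and `f1` for `k ≥ j`, and `ν_k` has law `p`. -/
def condLaw (j : ℕ) : Measure Path :=
  (Measure.dirac j).prod
    ((Measure.infinitePi fun k : ℕ => if k < j then M.law0 else M.law1).prod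
      (Measure.infinitePi fun _ : ℕ => M.p.toMeasure))

/-- `P_π^ν`. -/
def law : Measure Path :=
  Measure.sum fun j => ENNReal.ofReal (M.prior j) • M.condLaw j

/-- `N_k` along a path `n` of replenishments and a path `m` of sampling decisions:
`N_0 = N`, `N_k = min {C, N_{k-1} + ν_k - μ_k}`. -/
def rights (n : ℕ → ℕ) (m : ℕ → Bool) : ℕ → ℤ
  | 0 => M.N
  | k + 1 => min (M.C : ℤ) (rights n m k + n (k + 1) - (m (k + 1)).toNat)

/-- The observation `Z_k`: `X_k` if a sample is taken, and the blank symbol `Sum.inr ()` if not. -/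
def obs (μ : ℕ → Path → Bool) (k : ℕ) (ω : Path) : ℝ ⊕ Unit :=
  if μ k ω then Sum.inl (X k ω) else Sum.inr ()

/-- The σ-algebra `F_k` generated by `Z_1, …, Z_k`. -/
@[reducible] def obsInfo (μ : ℕ → Path → Bool) (k : ℕ) : MeasurableSpace Path :=
  ⨆ i ∈ Finset.Icc 1 k, MeasurableSpace.comap (obs μ i) inferInstance

/-- The information `Z_1, …, Z_{k-1}`, `ν_1, …, ν_k`, `μ_1, …, μ_{k-1}` on which the sampling
decision in slot `k` is based. -/
@[reducible] def decisionInfo (μ : ℕ → Path → Bool) (k : ℕ) : MeasurableSpace Path :=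
  (⨆ i ∈ Finset.Ico 1 k, MeasurableSpace.comap (obs μ i) inferInstance) ⊔
  (⨆ i ∈ Finset.Icc 1 k, MeasurableSpace.comap (nu i) inferInstance) ⊔
  (⨆ i ∈ Finset.Ico 1 k, MeasurableSpace.comap (μ i) inferInstance)

/-- The admissible sampling strategies: `μ_k` is a measurable function of
`Z_1, …, Z_{k-1}`, `ν_1, …, ν_k`, `μ_1, …, μ_{k-1}`, and `N_k ≥ 0` for all `k ≥ 1`. -/
def Admissible (μ : ℕ → Path → Bool) : Prop :=
  (∀ k, 1 ≤ k → Measurable[decisionInfo μ k] (μ k)) ∧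
  ∀ ω k, 1 ≤ k → 0 ≤ M.rights (fun i => nu i ω) (fun i => μ i ω) k

/-- Stopping times (possibly infinite) of the filtration generated by the observations. -/
def IsStopping (μ : ℕ → Path → Bool) (τ : Path → ℕ∞) : Prop :=
  ∀ k : ℕ, MeasurableSet[obsInfo μ k] {ω | τ ω ≤ k}

/-- The average detection delay `E[(τ - Λ)⁺]` (subtraction in `ℕ∞` is truncated at `0`). -/
def ADD (τ : Path → ℕ∞) : ℝ≥0∞ :=
  ∫⁻ ω, ((τ ω - (Lam ω : ℕ∞) : ℕ∞) : ℝ≥0∞) ∂M.law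

/-- The probability of false alarm `P(τ < Λ)`. -/
def PFA (τ : Path → ℕ∞) : ℝ≥0∞ :=
  M.law {ω | τ ω < (Lam ω : ℕ∞)}

/-- The least average detection delay among all admissible sampling strategies and stopping times
with false alarm probability at most `α`. -/
def optADD (α : ℝ) : ℝ≥0∞ :=
  ⨅ (μ : ℕ → Path → Bool) (τ : Path → ℕ∞) (_ : M.Admissible μ) (_ : IsStopping μ τ)
    (_ : M.PFA τ ≤ ENNReal.ofReal α), M.ADD τ

/-- The posterior probability `π_k = P(Λ ≤ k | F_k)` under the sampling strategy `μ`. -/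
def posterior (μ : ℕ → Path → Bool) (k : ℕ) : Path → ℝ :=
  condExp (obsInfo μ k) M.law (Set.indicator {ω | Lam ω ≤ k} fun _ => (1 : ℝ))

/-- The number of sampling rights left at the end of slot `k` when sampling greedily. -/
def greedyRights (n : ℕ → ℕ) : ℕ → ℤ
  | 0 => M.N
  | k + 1 => min (M.C : ℤ) (greedyRights n k + n (k + 1) -
      (decide (1 ≤ greedyRights n k + n (k + 1))).toNat)

/-- The greedy sampling strategy: `μ_k = 1` if and only if `N_{k-1} + ν_k ≥ 1`. -/
def greedy (k : ℕ) (ω : Path) : Bool :=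
  match k with
  | 0 => false
  | k + 1 => decide (1 ≤ M.greedyRights (fun i => nu i ω) k + nu (k + 1) ω)

/-- `greedyRights` is the number of sampling rights under the greedy strategy. -/
theorem rights_greedy (ω : Path) (k : ℕ) :
    M.rights (fun i => nu i ω) (fun i => M.greedy i ω) k =
      M.greedyRights (fun i => nu i ω) k := by
  induction k with
  | zero => rfl
  | succ k ih =>
    simp only [rights, greedyRights, ih]
    rfl

/-- The threshold rule `inf {k ≥ 0 : π_k ≥ 1 - α}` under greedy sampling (`⊤` if there is no such
`k`). -/
def threshold (α : ℝ) (ω : Path) : ℕ∞ :=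
  ⨅ (k : ℕ) (_ : 1 - α ≤ M.posterior M.greedy k ω), (k : ℕ∞)

/-- The probability of taking an observation in slot `k` under greedy sampling. -/
def greedyProb (k : ℕ) : ℝ := M.law.real {ω | M.greedy k ω = true}

/-- The long-run sampling probability `p̃` of the greedy strategy. -/
def pTilde : ℝ := limUnder atTop M.greedyProb

/-- The Kullback–Leibler divergence `D(f1 ‖ f0)`. -/
def klD : ℝ≥0∞ := InformationTheory.klDiv M.law1 M.law0

/-- The log-likelihood ratio `l(Z_k)` under the sampling strategy `μ`. -/
def loglik (μ : ℕ → Path → Bool) (k : ℕ) (ω : Path) : ℝ :=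
  if μ k ω then Real.log (M.f1 (X k ω) / M.f0 (X k ω)) else 0

/-- The last exit time `T_ε^{(j)}` under greedy sampling (`0` for the empty set). -/
def lastExit (ε : ℝ) (j : ℕ) (ω : Path) : ℕ∞ :=
  ⨆ (n : ℕ) (_ : 1 ≤ n ∧
    ε < |(1 / (n : ℝ)) * ∑ i ∈ Finset.Ico j (j + n), M.loglik M.greedy i ω
      - M.pTilde * M.klD.toReal|), (n : ℕ∞)

/-- `E_j^ν[T_ε^{(j)}]`. -/
def meanLastExit (ε : ℝ) (j : ℕ) : ℝ≥0∞ :=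
  ∫⁻ ω, (M.lastExit ε j ω : ℝ≥0∞) ∂M.condLaw j

/-- The first-order delay `|log α| / (p̃ D(f1 ‖ f0) + |log (1 - ρ)|)`. -/
def firstOrder (α : ℝ) : ℝ :=
  |Real.log α| / (M.pTilde * M.klD.toReal + |Real.log (1 - M.ρ)|)

end ChangeModel

end

noncomputable section

open ProbabilityTheory

section Independence

variable {α β γ δ : Type*} [MeasurableSpace α] [MeasurableSpace β] [MeasurableSpace γ]
  [MeasurableSpace δ]

theorem indepFun_prod_of_fst {P : Measure α} {Q : Measure β} [IsProbabilityMeasure P]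
    [IsProbabilityMeasure Q] {f : α → γ} {g : α → δ} (hf : Measurable f) (hg : Measurable g)
    (h : IndepFun f g P) :
    IndepFun (fun z : α × β => (f z.1, z.2)) (fun z : α × β => g z.1) (P.prod Q) := by
  rw [indepFun_iff_measure_inter_preimage_eq_mul] at h ⊢
  intro s t hs ht
  have hF : Measurable fun z : α × β => (f z.1, z.2) := by fun_prop
  have hG : Measurable fun z : α × β => g z.1 := by fun_prop
  have hm : (P.prod Q) ((fun z : α × β => g z.1) ⁻¹' t) = P (g ⁻¹' t) := by
    have : (fun z : α × β => g z.1) ⁻¹' t = (g ⁻¹' t) ×ˢ Set.univ := by ext; simp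
    rw [this, Measure.prod_prod]; simp
  rw [hm, Measure.prod_apply_symm ((hF hs).inter (hG ht)), Measure.prod_apply_symm (hF hs),
    ← lintegral_mul_const _ (measurable_measure_prodMk_right (hF hs))]
  refine lintegral_congr fun y => ?_
  have hy : MeasurableSet ((fun c : γ => (c, y)) ⁻¹' s) := measurable_prodMk_right hs
  exact h _ t hy ht

theorem indepFun_prod_of_snd {P : Measure α} {Q : Measure β} [IsProbabilityMeasure P]
    [IsProbabilityMeasure Q] {f : β → γ} {g : β → δ} (hf : Measurable f) (hg : Measurable g)
    (h : IndepFun f g Q) :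
    IndepFun (fun z : α × β => (z.1, f z.2)) (fun z : α × β => g z.2) (P.prod Q) := by
  rw [indepFun_iff_measure_inter_preimage_eq_mul] at h ⊢
  intro s t hs ht
  have hF : Measurable fun z : α × β => (z.1, f z.2) := by fun_prop
  have hG : Measurable fun z : α × β => g z.2 := by fun_prop
  have hm : (P.prod Q) ((fun z : α × β => g z.2) ⁻¹' t) = Q (g ⁻¹' t) := by
    have : (fun z : α × β => g z.2) ⁻¹' t = Set.univ ×ˢ (g ⁻¹' t) := by ext; simp
    rw [this, Measure.prod_prod]; simp
  rw [hm, Measure.prod_apply ((hF hs).inter (hG ht)), Measure.prod_apply (hF hs),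
    ← lintegral_mul_const _ (measurable_measure_prodMk_left (hF hs))]
  refine lintegral_congr fun y => ?_
  have hy : MeasurableSet ((fun c : γ => (y, c)) ⁻¹' s) := measurable_prodMk_left hs
  exact h _ t hy ht

theorem indepFun_restrict_Iic_succ_infinitePi (Q : ℕ → Measure α)
    [∀ i, IsProbabilityMeasure (Q i)] (k : ℕ) :
    IndepFun (fun x : ℕ → α => (Finset.Iic k).restrict x) (fun x : ℕ → α => x (k + 1))
      (Measure.infinitePi Q) := by
  have h : iIndepFun (fun (i : ℕ) (x : ℕ → α) => x i) (Measure.infinitePi Q) :=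
    iIndepFun_infinitePi (X := fun _ => id) (fun _ => measurable_id)
  have h2 := h.indepFun_finset (Finset.Iic k) {k + 1} (by simp) (fun i => measurable_pi_apply i)
  exact h2.comp (φ := id) (ψ := fun y : ({k + 1} : Finset ℕ) → α => y ⟨k + 1, by simp⟩)
    measurable_id (measurable_pi_apply _)

end Independence

namespace ChangeModel

variable (M : ChangeModel)

instance : IsProbabilityMeasure M.law0 := ⟨by
  rw [law0, withDensity_apply _ MeasurableSet.univ]; simpa using M.lintegral_f0⟩

instance : IsProbabilityMeasure M.law1 := ⟨by
  rw [law1, withDensity_apply _ MeasurableSet.univ]; simpa using M.lintegral_f1⟩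

instance (P : Prop) [Decidable P] : IsProbabilityMeasure (if P then M.law0 else M.law1) := by
  split_ifs <;> infer_instance

/-- The law of a path with deterministic change point `j` and independent `X_k` of law `Q k`. -/
def pathLaw (j : ℕ) (Q : ℕ → Measure ℝ) : Measure Path :=
  (Measure.dirac j).prod ((Measure.infinitePi Q).prod
    (Measure.infinitePi fun _ : ℕ => M.p.toMeasure))

instance (j : ℕ) (Q : ℕ → Measure ℝ) [∀ i, IsProbabilityMeasure (Q i)] :
    IsProbabilityMeasure (M.pathLaw j Q) := by
  unfold pathLaw; infer_instance

theorem condLaw_eq_pathLaw (j : ℕ) :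
    M.condLaw j = M.pathLaw j fun k => if k < j then M.law0 else M.law1 := rfl

instance (j : ℕ) : IsProbabilityMeasure (M.condLaw j) := by
  rw [condLaw_eq_pathLaw]; infer_instance

/-- The law under which the change never happens. -/
def nullLaw : Measure Path := M.pathLaw 0 fun _ => M.law0

instance : IsProbabilityMeasure M.nullLaw := by
  unfold nullLaw; infer_instance

theorem measurable_Lam : Measurable Lam := measurable_fst

theorem measurable_X (k : ℕ) : Measurable (X k) := by unfold X; fun_prop

theorem measurable_nu (k : ℕ) : Measurable (nu k) := by unfold nu; fun_prop

/-- The values `X_i`, `i ≤ k`, together with all replenishments. -/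
def sampleMap (k : ℕ) (ω : Path) : (Finset.Iic k → ℝ) × (ℕ → ℕ) :=
  ((Finset.Iic k).restrict ω.2.1, ω.2.2)

/-- The change point, all the values `X_i`, and the replenishments `ν_i`, `i ≤ k`. -/
def pastMap (k : ℕ) (ω : Path) : ℕ × (ℕ → ℝ) × (Finset.Iic k → ℕ) :=
  (ω.1, ω.2.1, (Finset.Iic k).restrict ω.2.2)

theorem measurable_sampleMap (k : ℕ) : Measurable (sampleMap k) := by
  have := Finset.measurable_restrict (X := fun _ : ℕ => ℝ) (Finset.Iic k)
  unfold sampleMap; fun_prop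

theorem measurable_pastMap (k : ℕ) : Measurable (pastMap k) := by
  have := Finset.measurable_restrict (X := fun _ : ℕ => ℕ) (Finset.Iic k)
  unfold pastMap; fun_prop

theorem indepFun_sampleMap (j : ℕ) (Q : ℕ → Measure ℝ) [∀ i, IsProbabilityMeasure (Q i)]
    (k : ℕ) : IndepFun (sampleMap k) (X (k + 1)) (M.pathLaw j Q) := by
  have h1 := indepFun_prod_of_fst (Q := Measure.infinitePi fun _ : ℕ => M.p.toMeasure)
    (Finset.measurable_restrict (X := fun _ : ℕ => ℝ) (Finset.Iic k)) (measurable_pi_apply (k + 1))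
    (indepFun_restrict_Iic_succ_infinitePi Q k)
  have h2 := indepFun_prod_of_snd (P := Measure.dirac j)
    (by have := Finset.measurable_restrict (X := fun _ : ℕ => ℝ) (Finset.Iic k); fun_prop)
    (by fun_prop) h1
  exact h2.comp (φ := Prod.snd) (ψ := id) measurable_snd measurable_id

theorem indepFun_pastMap (j : ℕ) (Q : ℕ → Measure ℝ) [∀ i, IsProbabilityMeasure (Q i)]
    (k : ℕ) : IndepFun (pastMap k) (nu (k + 1)) (M.pathLaw j Q) := by
  have h1 := indepFun_prod_of_snd (P := Measure.infinitePi Q)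
    (Finset.measurable_restrict (X := fun _ : ℕ => ℕ) (Finset.Iic k)) (measurable_pi_apply (k + 1))
    (indepFun_restrict_Iic_succ_infinitePi (fun _ => M.p.toMeasure) k)
  exact indepFun_prod_of_snd (P := Measure.dirac j)
    (by have := Finset.measurable_restrict (X := fun _ : ℕ => ℕ) (Finset.Iic k); fun_prop)
    (by fun_prop) h1

theorem map_X_pathLaw (j : ℕ) (Q : ℕ → Measure ℝ) [∀ i, IsProbabilityMeasure (Q i)] (k : ℕ) :
    (M.pathLaw j Q).map (X k) = Q k := by
  have : X k = (fun x : ℕ → ℝ => x k) ∘ Prod.fst ∘ (Prod.snd : Path → _) := rfl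
  rw [this, ← Measure.map_map (by fun_prop) (by fun_prop),
    ← Measure.map_map (by fun_prop) (by fun_prop), pathLaw, Measure.map_snd_prod, measure_univ,
    one_smul, Measure.map_fst_prod, measure_univ, one_smul]
  exact Measure.infinitePi_map_eval Q k

theorem map_nu_pathLaw (j : ℕ) (Q : ℕ → Measure ℝ) [∀ i, IsProbabilityMeasure (Q i)] (k : ℕ) :
    (M.pathLaw j Q).map (nu k) = M.p.toMeasure := by
  have : nu k = (fun x : ℕ → ℕ => x k) ∘ Prod.snd ∘ (Prod.snd : Path → _) := rfl
  rw [this, ← Measure.map_map (by fun_prop) (by fun_prop),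
    ← Measure.map_map (by fun_prop) (by fun_prop), pathLaw, Measure.map_snd_prod, measure_univ,
    one_smul, Measure.map_snd_prod, measure_univ, one_smul]
  exact Measure.infinitePi_map_eval (fun _ => M.p.toMeasure) k

theorem map_sampleMap_condLaw {j k : ℕ} (h : k < j) :
    (M.condLaw j).map (sampleMap k) = M.nullLaw.map (sampleMap k) := by
  have key : ∀ (i : ℕ) (Q : ℕ → Measure ℝ) [∀ i, IsProbabilityMeasure (Q i)],
      (M.pathLaw i Q).map (sampleMap k) =
        (Measure.pi fun i : Finset.Iic k => Q i).prod
          (Measure.infinitePi fun _ : ℕ => M.p.toMeasure) := by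
    intro i Q _
    have hr := Finset.measurable_restrict (X := fun _ : ℕ => ℝ) (Finset.Iic k)
    have : sampleMap k = Prod.map (Finset.Iic k).restrict id ∘ (Prod.snd : Path → _) := rfl
    rw [this, ← Measure.map_map (by fun_prop) (by fun_prop), pathLaw, Measure.map_snd_prod,
      measure_univ, one_smul, ← Measure.map_prod_map _ _ hr measurable_id, Measure.map_id,
      Measure.infinitePi_map_restrict]
  rw [condLaw_eq_pathLaw, nullLaw, key, key]
  congr 2
  funext i
  have hi : (i : ℕ) ≤ k := Finset.mem_Iic.1 i.2
  rw [if_pos (by omega)]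

theorem Lam_condLaw (j : ℕ) : ∀ᵐ ω ∂M.condLaw j, Lam ω = j := by
  have h : (M.condLaw j).map Lam = Measure.dirac j := by
    unfold Lam
    rw [condLaw, Measure.map_fst_prod, measure_univ, one_smul]
  have h2 : ∀ᵐ i ∂(M.condLaw j).map Lam, i = j := by rw [h]; simp
  exact ae_of_ae_map measurable_Lam.aemeasurable h2

theorem prior_nonneg (j : ℕ) : 0 ≤ M.prior j := by
  unfold prior
  have := M.π₀_lt_one; have := M.ρ_pos; have := M.ρ_lt_one
  split_ifs
  · exact M.π₀_nonneg
  · have : 0 < 1 - M.ρ := by linarith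
    have : 0 < 1 - M.π₀ := by linarith
    positivity

/-- `P(Λ > k)`. -/
def priorTail (k : ℕ) : ℝ := (1 - M.π₀) * (1 - M.ρ) ^ k

theorem priorTail_pos (k : ℕ) : 0 < M.priorTail k := by
  have : 0 < 1 - M.ρ := by linarith [M.ρ_lt_one]
  have : 0 < 1 - M.π₀ := by linarith [M.π₀_lt_one]
  unfold priorTail; positivity

theorem prior_succ (k : ℕ) : M.prior (k + 1) = M.ρ * M.priorTail k := by
  simp only [prior, priorTail, Nat.succ_ne_zero, if_false, Nat.add_sub_cancel]; ring

theorem priorTail_succ (k : ℕ) : M.priorTail (k + 1) = (1 - M.ρ) * M.priorTail k := by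
  simp only [priorTail]; ring

theorem hasSum_prior_tail (k : ℕ) : HasSum (fun i => M.prior (k + 1 + i)) (M.priorTail k) := by
  have h1 : |1 - M.ρ| < 1 := by rw [abs_lt]; constructor <;> linarith [M.ρ_pos, M.ρ_lt_one]
  have h := (hasSum_geometric_of_abs_lt_one h1).mul_left (M.ρ * M.priorTail k)
  convert! h using 1
  · funext i
    rw [show k + 1 + i = (k + i) + 1 by ring, prior_succ, priorTail, priorTail, pow_add]; ring
  · have := M.ρ_pos
    rw [sub_sub_cancel, mul_right_comm, mul_inv_cancel₀ this.ne', one_mul]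

theorem hasSum_prior : HasSum M.prior 1 := by
  have h := (hasSum_nat_add_iff (f := M.prior) 1).1
    (by simpa [add_comm] using M.hasSum_prior_tail 0)
  simpa [priorTail, prior] using h

theorem law_apply {s : Set Path} (hs : MeasurableSet s) :
    M.law s = ∑' j, ENNReal.ofReal (M.prior j) * M.condLaw j s := by
  rw [law, Measure.sum_apply _ hs]
  rfl

instance : IsProbabilityMeasure M.law := ⟨by
  rw [law_apply _ MeasurableSet.univ]
  simp only [measure_univ, mul_one]
  rw [← ENNReal.ofReal_tsum_of_nonneg M.prior_nonneg M.hasSum_prior.summable,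
    M.hasSum_prior.tsum_eq, ENNReal.ofReal_one]⟩

theorem lintegral_law (f : Path → ℝ≥0∞) :
    ∫⁻ ω, f ω ∂M.law = ∑' j, ENNReal.ofReal (M.prior j) * ∫⁻ ω, f ω ∂M.condLaw j := by
  rw [law, lintegral_sum_measure]
  simp [lintegral_smul_measure]

theorem condLaw_inter_Lam {s : Set Path} (j : ℕ) (p : ℕ → Prop) [Decidable (p j)] :
    M.condLaw j (s ∩ {ω | p (Lam ω)}) = if p j then M.condLaw j s else 0 := by
  split_ifs with h
  · refine measure_congr ?_
    filter_upwards [M.Lam_condLaw j] with ω hω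
    refine propext ⟨fun h => h.1, fun h' => ⟨h', ?_⟩⟩
    rwa [Set.mem_ofPred_eq, hω]
  · rw [measure_eq_zero_iff_ae_notMem]
    filter_upwards [M.Lam_condLaw j] with ω hω h'
    exact h (hω ▸ h'.2)

theorem measurableSet_Lam (p : ℕ → Prop) : MeasurableSet {ω : Path | p (Lam ω)} :=
  measurable_Lam (measurableSet_setOfPred.2 (measurable_of_countable p))

theorem condLaw_nu_preimage (k : ℕ) (t : Set ℕ) (ht : MeasurableSet t) (j : ℕ) :
    M.condLaw j (nu k ⁻¹' t) = M.p.toMeasure t := by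
  rw [← Measure.map_apply (measurable_nu _) ht, condLaw_eq_pathLaw, map_nu_pathLaw]

theorem map_nu_law (k : ℕ) : M.law.map (nu k) = M.p.toMeasure := by
  ext t ht
  rw [Measure.map_apply (measurable_nu _) ht, law_apply _ (measurable_nu _ ht)]
  simp only [M.condLaw_nu_preimage k t ht]
  rw [ENNReal.tsum_mul_right]
  have := measure_univ (μ := M.law)
  rw [law_apply _ MeasurableSet.univ] at this
  simp only [measure_univ, mul_one] at this
  rw [this, one_mul]

theorem indepFun_pastMap_law (k : ℕ) : IndepFun (pastMap k) (nu (k + 1)) M.law := by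
  rw [indepFun_iff_measure_inter_preimage_eq_mul]
  intro s t hs ht
  have hνl := M.map_nu_law (k + 1)
  have hν := M.condLaw_nu_preimage (k + 1) t ht
  rw [← hνl, Measure.map_apply (measurable_nu _) ht] at hν
  rw [law_apply _ ((measurable_pastMap _ hs).inter (measurable_nu _ ht)),
    law_apply _ (measurable_pastMap _ hs), ← ENNReal.tsum_mul_right]
  refine tsum_congr fun j => ?_
  have h := (indepFun_iff_measure_inter_preimage_eq_mul.1
    (M.indepFun_pastMap j (fun k => if k < j then M.law0 else M.law1) k)) s t hs ht
  rw [← condLaw_eq_pathLaw] at h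
  rw [h, hν, mul_assoc]

/-- Integrating out `ν_{k+1}` given the past. -/
theorem lintegral_past_nu {E : Type*} [MeasurableSpace E] {k : ℕ} {W : Path → E}
    (hW : Measurable[MeasurableSpace.comap (pastMap k) inferInstance] W) {φ : E × ℕ → ℝ≥0∞}
    (hφ : Measurable φ) :
    ∫⁻ ω, φ (W ω, nu (k + 1) ω) ∂M.law = ∫⁻ ω, ∫⁻ v, φ (W ω, v) ∂M.p.toMeasure ∂M.law := by
  have hWm : Measurable W := hW.mono (measurable_pastMap k).comap_le le_rfl
  have hi : IndepFun W (nu (k + 1)) M.law :=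
    indep_of_indep_of_le_left (M.indepFun_pastMap_law k) hW.comap_le
  have hm := (indepFun_iff_map_prod_eq_prod_map_map hWm.aemeasurable
    (measurable_nu (k + 1)).aemeasurable).1 hi
  rw [map_nu_law] at hm
  rw [← lintegral_map (f := φ) hφ (hWm.prodMk (measurable_nu _)), hm,
    lintegral_prod _ hφ.aemeasurable,
    lintegral_map (hφ.lintegral_prod_right') hWm]

end ChangeModel

section Sigma

theorem MeasureTheory.Measure.apply_eq_of_sup {α : Type*} {m0 m1 m2 : MeasurableSpace α}
    {P Q : @Measure α m0} [IsFiniteMeasure P] (h1 : m1 ≤ m0) (h2 : m2 ≤ m0)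
    (h : ∀ s t, MeasurableSet[m1] s → MeasurableSet[m2] t → P (s ∩ t) = Q (s ∩ t))
    {s : Set α} (hs : MeasurableSet[m1 ⊔ m2] s) : P s = Q s := by
  let C : Set (Set α) := {u | ∃ s t, MeasurableSet[m1] s ∧ MeasurableSet[m2] t ∧ u = s ∩ t}
  refine ext_on_measurableSpace_of_generate_finite m0 C ?_ (sup_le h1 h2) ?_ ?_ ?_ hs
  · rintro _ ⟨s, t, hs, ht, rfl⟩
    exact h s t hs ht
  · refine le_antisymm (sup_le ?_ ?_) (MeasurableSpace.generateFrom_le ?_)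
    · exact fun s hs => MeasurableSpace.measurableSet_generateFrom
        ⟨s, Set.univ, hs, MeasurableSet.univ, by simp⟩
    · exact fun s hs => MeasurableSpace.measurableSet_generateFrom
        ⟨Set.univ, s, MeasurableSet.univ, hs, by simp⟩
    · rintro _ ⟨s, t, hs, ht, rfl⟩
      exact MeasurableSet.inter (le_sup_left (b := m2) _ hs) (le_sup_right (a := m1) _ ht)
  · rintro _ ⟨s, t, hs, ht, rfl⟩ _ ⟨s', t', hs', ht', rfl⟩ _
    exact ⟨s ∩ s', t ∩ t', hs.inter hs', ht.inter ht', Set.inter_inter_inter_comm _ _ _ _⟩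
  · simpa using h Set.univ Set.univ MeasurableSet.univ MeasurableSet.univ

theorem MeasureTheory.lintegral_congr_of_measurableSet {α : Type*} {m m0 : MeasurableSpace α}
    {P Q : @Measure α m0} (hm : m ≤ m0) (h : ∀ s, MeasurableSet[m] s → P s = Q s)
    {f : α → ℝ≥0∞} (hf : Measurable[m] f) : ∫⁻ x, f x ∂P = ∫⁻ x, f x ∂Q := by
  have ht : P.trim hm = Q.trim hm := by
    refine @Measure.ext _ m _ _ fun s hs => ?_
    rw [trim_measurableSet_eq hm hs, trim_measurableSet_eq hm hs, h s hs]
  rw [← lintegral_trim hm hf, ht, lintegral_trim hm hf]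

end Sigma

namespace ChangeModel

variable (M : ChangeModel) {μ : ℕ → Path → Bool}

/-- The likelihood ratio `f1 / f0`. -/
def lr (x : ℝ) : ℝ := M.f1 x / M.f0 x

theorem measurable_lr : Measurable M.lr := M.measurable_f1.div M.measurable_f0

theorem lr_nonneg (x : ℝ) : 0 ≤ M.lr x := div_nonneg (M.f1_nonneg x) (M.f0_nonneg x)

/-- The likelihood ratio of an observation, `1` for a blank. -/
def obsLR : ℝ ⊕ Unit → ℝ := Sum.elim M.lr fun _ => 1

theorem measurable_obsLR : Measurable M.obsLR := M.measurable_lr.sumElim measurable_const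

theorem obsLR_nonneg (z : ℝ ⊕ Unit) : 0 ≤ M.obsLR z := by
  rcases z with x | x
  · exact M.lr_nonneg x
  · exact zero_le_one

theorem law1_absolutelyContinuous (hD : M.klD ≠ ⊤) : M.law1 ≪ M.law0 :=
  (InformationTheory.klDiv_ne_top_iff.1 hD).1

theorem law0_f0_pos : ∀ᵐ x ∂M.law0, 0 < M.f0 x := by
  unfold law0
  rw [ae_withDensity_iff (by have := M.measurable_f0; fun_prop)]
  filter_upwards with x hx
  simpa using hx

theorem law1_f1_pos : ∀ᵐ x ∂M.law1, 0 < M.f1 x := by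
  unfold law1
  rw [ae_withDensity_iff (by have := M.measurable_f1; fun_prop)]
  filter_upwards with x hx
  simpa using hx

theorem law1_lr_pos (hD : M.klD ≠ ⊤) : ∀ᵐ x ∂M.law1, 0 < M.lr x := by
  filter_upwards [M.law1_f1_pos, (M.law1_absolutelyContinuous hD).ae_le M.law0_f0_pos]
    with x h1 h0
  exact div_pos h1 h0

theorem law1_eq_withDensity (hD : M.klD ≠ ⊤) :
    M.law1 = M.law0.withDensity fun x => ENNReal.ofReal (M.lr x) := by
  have h0 : Measurable fun x => ENNReal.ofReal (M.f0 x) := by have := M.measurable_f0; fun_prop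
  have hl : Measurable fun x => ENNReal.ofReal (M.lr x) := by have := M.measurable_lr; fun_prop
  ext s hs
  have hz : MeasurableSet {x | 0 < M.f0 x} := measurableSet_lt measurable_const M.measurable_f0
  have h1 : M.law1 s = M.law1 (s ∩ {x | 0 < M.f0 x}) := by
    refine measure_congr ?_
    filter_upwards [(M.law1_absolutelyContinuous hD).ae_le M.law0_f0_pos] with x hx
    exact propext ⟨fun h => ⟨h, hx⟩, fun h => h.1⟩
  rw [h1, law1, law0, ← withDensity_mul _ h0 hl, withDensity_apply _ (hs.inter hz),
    withDensity_apply _ hs, ← lintegral_indicator (hs.inter hz), ← lintegral_indicator hs]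
  refine lintegral_congr fun x => ?_
  by_cases hx : x ∈ s
  · by_cases hp : 0 < M.f0 x
    · rw [Set.indicator_of_mem (show x ∈ s ∩ {x | 0 < M.f0 x} from ⟨hx, hp⟩), Set.indicator_of_mem hx, Pi.mul_apply,
        ← ENNReal.ofReal_mul (M.f0_nonneg x), lr, mul_div_cancel₀ _ hp.ne']
    · rw [Set.indicator_of_notMem (fun h => hp h.2), Set.indicator_of_mem hx, Pi.mul_apply,
        ENNReal.ofReal_of_nonpos (not_lt.1 hp), zero_mul]
  · rw [Set.indicator_of_notMem (fun h => hx h.1), Set.indicator_of_notMem hx]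

theorem klD_eq_lintegral (hD : M.klD ≠ ⊤) :
    ∫⁻ x, ENNReal.ofReal (InformationTheory.klFun (M.lr x)) ∂M.law0 = M.klD := by
  rw [klD, InformationTheory.klDiv_eq_lintegral_klFun_of_ac (M.law1_absolutelyContinuous hD)]
  refine lintegral_congr_ae ?_
  have hl : Measurable fun x => ENNReal.ofReal (M.lr x) := by have := M.measurable_lr; fun_prop
  have h := Measure.rnDeriv_withDensity M.law0 hl
  rw [← law1_eq_withDensity M hD] at h
  filter_upwards [h] with x hx
  rw [hx, ENNReal.toReal_ofReal (M.lr_nonneg x)]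

/-! ### Information -/

/-- The information `Z_1, …, Z_k` together with all replenishments. -/
@[reducible] def fullInfo (μ : ℕ → Path → Bool) (k : ℕ) : MeasurableSpace Path :=
  obsInfo μ k ⊔ MeasurableSpace.comap (fun ω : Path => ω.2.2) inferInstance

/-- The sampling decisions are based on the available information. -/
def Adapted (μ : ℕ → Path → Bool) : Prop :=
  ∀ k, 1 ≤ k → Measurable[decisionInfo μ k] (μ k)

theorem obsInfo_succ (μ : ℕ → Path → Bool) (k : ℕ) :
    obsInfo μ (k + 1) = obsInfo μ k ⊔ MeasurableSpace.comap (obs μ (k + 1)) inferInstance := by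
  have h : Finset.Icc 1 (k + 1) = insert (k + 1) (Finset.Icc 1 k) := by
    ext i; simp only [Finset.mem_Icc, Finset.mem_insert]; omega
  simp only [obsInfo]
  rw [h, Finset.iSup_insert, sup_comm]

theorem obsInfo_mono (μ : ℕ → Path → Bool) : Monotone (obsInfo μ) :=
  monotone_nat_of_le_succ fun k => by rw [obsInfo_succ]; exact le_sup_left

theorem comap_obs_le_obsInfo (μ : ℕ → Path → Bool) {i k : ℕ} (h1 : 1 ≤ i) (h : i ≤ k) :
    MeasurableSpace.comap (obs μ i) inferInstance ≤ obsInfo μ k :=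
  le_iSup₂_of_le i (Finset.mem_Icc.2 ⟨h1, h⟩) le_rfl

theorem fullInfo_succ (μ : ℕ → Path → Bool) (k : ℕ) :
    fullInfo μ (k + 1) = fullInfo μ k ⊔ MeasurableSpace.comap (obs μ (k + 1)) inferInstance := by
  simp only [fullInfo, obsInfo_succ]
  rw [sup_assoc, sup_assoc, sup_comm (MeasurableSpace.comap _ _)]

theorem fullInfo_mono (μ : ℕ → Path → Bool) : Monotone (fullInfo μ) :=
  monotone_nat_of_le_succ fun k => by rw [fullInfo_succ]; exact le_sup_left

theorem comap_le_comap_obs (μ : ℕ → Path → Bool) (i : ℕ) :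
    MeasurableSpace.comap (μ i) inferInstance ≤
      MeasurableSpace.comap (obs μ i) inferInstance := by
  have h : μ i = Sum.isLeft ∘ obs μ i := by
    funext ω
    simp only [Function.comp, obs]
    cases μ i ω <;> simp
  have hm : Measurable (Sum.isLeft : ℝ ⊕ Unit → Bool) :=
    measurable_fun_sum measurable_const measurable_const
  have h2 : Measurable[MeasurableSpace.comap (obs μ i) inferInstance] (μ i) := by
    rw [h]
    exact hm.comp (comap_measurable (obs μ i))
  exact h2.comap_le

theorem decisionInfo_le {m : MeasurableSpace Path} {k : ℕ} (h1 : obsInfo μ k ≤ m)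
    (h2 : ∀ i ≤ k + 1, MeasurableSpace.comap (nu i) inferInstance ≤ m) :
    decisionInfo μ (k + 1) ≤ m := by
  refine sup_le (sup_le (iSup₂_le fun i hi => ?_) (iSup₂_le fun i hi => ?_))
    (iSup₂_le fun i hi => ?_)
  · rw [Finset.mem_Ico] at hi
    exact (comap_obs_le_obsInfo μ hi.1 (by omega)).trans h1
  · exact h2 i (Finset.mem_Icc.1 hi).2
  · rw [Finset.mem_Ico] at hi
    exact (comap_le_comap_obs μ i).trans ((comap_obs_le_obsInfo μ hi.1 (by omega)).trans h1)

theorem Adapted.measurable_fullInfo (hμ : Adapted μ) (k : ℕ) :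
    Measurable[fullInfo μ k] (μ (k + 1)) := by
  refine (hμ (k + 1) (by omega)).mono (decisionInfo_le le_sup_left fun i _ => ?_) le_rfl
  refine le_trans ?_ le_sup_right
  exact Measurable.comap_le ((measurable_pi_apply i).comp (comap_measurable _))

theorem measurable_obs_of {m : MeasurableSpace Path} {k : ℕ} (h1 : Measurable[m] (μ k))
    (h2 : Measurable[m] (X k)) : Measurable[m] (obs μ k) := by
  unfold obs
  exact Measurable.ite (h1 (measurableSet_singleton true)) (measurable_inl.comp h2)
    measurable_const

theorem measurable_X_sampleMap {i k : ℕ} (h : i ≤ k) :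
    Measurable[MeasurableSpace.comap (sampleMap k) inferInstance] (X i) := by
  have : X i = (fun z : (Finset.Iic k → ℝ) × (ℕ → ℕ) => z.1 ⟨i, Finset.mem_Iic.2 h⟩) ∘
      sampleMap k := rfl
  rw [this]
  exact Measurable.comp (by fun_prop) (comap_measurable _)

theorem comap_sampleMap_le_succ (k : ℕ) :
    MeasurableSpace.comap (sampleMap k) inferInstance ≤
      MeasurableSpace.comap (sampleMap (k + 1)) inferInstance := by
  have : sampleMap k = (fun z : (Finset.Iic (k + 1) → ℝ) × (ℕ → ℕ) =>
      ((fun i : Finset.Iic k => z.1 ⟨i, Finset.mem_Iic.2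
        ((Finset.mem_Iic.1 i.2).trans (Nat.le_succ k))⟩), z.2)) ∘ sampleMap (k + 1) := rfl
  rw [this]
  exact Measurable.comap_le (Measurable.comp (by fun_prop) (comap_measurable _))

theorem Adapted.fullInfo_le (hμ : Adapted μ) (k : ℕ) :
    fullInfo μ k ≤ MeasurableSpace.comap (sampleMap k) inferInstance := by
  induction k with
  | zero =>
    refine sup_le (iSup₂_le fun i hi => by simp at hi) ?_
    have : (fun ω : Path => ω.2.2) = Prod.snd ∘ sampleMap 0 := rfl
    rw [this]
    exact Measurable.comap_le (measurable_snd.comp (comap_measurable (sampleMap 0)))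
  | succ k ih =>
    rw [fullInfo_succ]
    have ih' := ih.trans (comap_sampleMap_le_succ k)
    refine sup_le ih' (Measurable.comap_le ?_)
    exact measurable_obs_of ((hμ.measurable_fullInfo k).mono ih' le_rfl)
      (measurable_X_sampleMap le_rfl)

theorem Adapted.fullInfo_le_univ (hμ : Adapted μ) (k : ℕ) :
    fullInfo μ k ≤ (inferInstance : MeasurableSpace Path) :=
  (hμ.fullInfo_le k).trans (measurable_sampleMap k).comap_le

theorem Adapted.obsInfo_le_univ (hμ : Adapted μ) (k : ℕ) :
    obsInfo μ k ≤ (inferInstance : MeasurableSpace Path) :=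
  le_sup_left.trans (hμ.fullInfo_le_univ k)

theorem comap_pastMap_le_succ (k : ℕ) :
    MeasurableSpace.comap (pastMap k) inferInstance ≤
      MeasurableSpace.comap (pastMap (k + 1)) inferInstance := by
  have : pastMap k = (fun z : ℕ × (ℕ → ℝ) × (Finset.Iic (k + 1) → ℕ) =>
      (z.1, z.2.1, (fun i : Finset.Iic k => z.2.2 ⟨i, Finset.mem_Iic.2
        ((Finset.mem_Iic.1 i.2).trans (Nat.le_succ k))⟩))) ∘ pastMap (k + 1) := rfl
  rw [this]
  exact Measurable.comap_le (Measurable.comp (by fun_prop) (comap_measurable _))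

theorem measurable_X_pastMap (i k : ℕ) :
    Measurable[MeasurableSpace.comap (pastMap k) inferInstance] (X i) := by
  have : X i = (fun z : ℕ × (ℕ → ℝ) × (Finset.Iic k → ℕ) => z.2.1 i) ∘ pastMap k := rfl
  rw [this]
  exact Measurable.comp (by fun_prop) (comap_measurable _)

theorem measurable_Lam_pastMap (k : ℕ) :
    Measurable[MeasurableSpace.comap (pastMap k) inferInstance] Lam := by
  have : Lam = (fun z : ℕ × (ℕ → ℝ) × (Finset.Iic k → ℕ) => z.1) ∘ pastMap k := rfl
  rw [this]
  exact Measurable.comp (by fun_prop) (comap_measurable _)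

theorem measurable_nu_pastMap {i k : ℕ} (h : i ≤ k) :
    Measurable[MeasurableSpace.comap (pastMap k) inferInstance] (nu i) := by
  have : nu i = (fun z : ℕ × (ℕ → ℝ) × (Finset.Iic k → ℕ) =>
    z.2.2 ⟨i, Finset.mem_Iic.2 h⟩) ∘ pastMap k := rfl
  rw [this]
  exact Measurable.comp (by fun_prop) (comap_measurable _)

theorem Adapted.measurable_pastMap_of_obsInfo_le (hμ : Adapted μ) {k : ℕ}
    (h : obsInfo μ k ≤ MeasurableSpace.comap (pastMap k) inferInstance) :
    Measurable[MeasurableSpace.comap (pastMap (k + 1)) inferInstance] (μ (k + 1)) :=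
  (hμ (k + 1) (by omega)).mono
    (decisionInfo_le (h.trans (comap_pastMap_le_succ k))
      fun _ hi => (measurable_nu_pastMap hi).comap_le) le_rfl

theorem Adapted.obsInfo_le (hμ : Adapted μ) (k : ℕ) :
    obsInfo μ k ≤ MeasurableSpace.comap (pastMap k) inferInstance := by
  induction k with
  | zero => exact iSup₂_le fun i hi => by simp at hi
  | succ k ih =>
    rw [obsInfo_succ]
    exact sup_le (ih.trans (comap_pastMap_le_succ k)) (Measurable.comap_le
      (measurable_obs_of (hμ.measurable_pastMap_of_obsInfo_le ih) (measurable_X_pastMap _ _)))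

theorem Adapted.measurable_pastMap (hμ : Adapted μ) (k : ℕ) :
    Measurable[MeasurableSpace.comap (pastMap (k + 1)) inferInstance] (μ (k + 1)) :=
  hμ.measurable_pastMap_of_obsInfo_le (hμ.obsInfo_le k)

end ChangeModel

namespace ChangeModel

variable (M : ChangeModel) {μ : ℕ → Path → Bool}

/-- Integrating out `Z_{k+1}` given the information up to slot `k`. -/
theorem Adapted.lintegral_obs_succ (hμ : Adapted μ) (j : ℕ) (Q : ℕ → Measure ℝ)
    [∀ i, IsProbabilityMeasure (Q i)] {k : ℕ} {G : Path → ℝ≥0∞} (hG : Measurable[fullInfo μ k] G)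
    {h : ℝ ⊕ Unit → ℝ≥0∞} (hh : Measurable h) :
    ∫⁻ ω, G ω * h (obs μ (k + 1) ω) ∂M.pathLaw j Q =
      ∫⁻ ω, G ω * (if μ (k + 1) ω then ∫⁻ x, h (Sum.inl x) ∂Q (k + 1) else h (Sum.inr ()))
        ∂M.pathLaw j Q := by
  set S : Set Path := {ω | μ (k + 1) ω = true} with hSdef
  have hS : MeasurableSet[fullInfo μ k] S :=
    hμ.measurable_fullInfo k (measurableSet_singleton true)
  have hle := hμ.fullInfo_le_univ k
  have hG1 : Measurable[fullInfo μ k] (S.indicator G) := hG.indicator hS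
  have hG2 : Measurable[fullInfo μ k] (Sᶜ.indicator G) := hG.indicator hS.compl
  have hG1' := hG1.mono hle le_rfl
  have hG2' := hG2.mono hle le_rfl
  have hl : Measurable fun x => h (Sum.inl x) := hh.comp measurable_inl
  have hX := measurable_X (k + 1)
  have e1 : ∀ ω, G ω * h (obs μ (k + 1) ω) =
      S.indicator G ω * h (Sum.inl (X (k + 1) ω)) + Sᶜ.indicator G ω * h (Sum.inr ()) := by
    intro ω
    by_cases hω : μ (k + 1) ω = true
    · have h1 : ω ∈ S := hω
      simp [obs, hω, h1]
    · have h1 : ω ∉ S := hω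
      simp [obs, hω, h1]
  have e2 : ∀ ω, G ω * (if μ (k + 1) ω then ∫⁻ x, h (Sum.inl x) ∂Q (k + 1) else h (Sum.inr ())) =
      S.indicator G ω * (∫⁻ x, h (Sum.inl x) ∂Q (k + 1)) +
        Sᶜ.indicator G ω * h (Sum.inr ()) := by
    intro ω
    by_cases hω : μ (k + 1) ω = true
    · have h1 : ω ∈ S := hω
      simp [hω, h1]
    · have h1 : ω ∉ S := hω
      simp [hω, h1]
  have hi : Indep (fullInfo μ k) (MeasurableSpace.comap (X (k + 1)) inferInstance)
      (M.pathLaw j Q) :=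
    indep_of_indep_of_le_left (M.indepFun_sampleMap j Q k) (hμ.fullInfo_le k)
  have hprod : ∫⁻ ω, S.indicator G ω * h (Sum.inl (X (k + 1) ω)) ∂M.pathLaw j Q =
      (∫⁻ ω, S.indicator G ω ∂M.pathLaw j Q) * ∫⁻ x, h (Sum.inl x) ∂Q (k + 1) := by
    have h2 := lintegral_mul_eq_lintegral_mul_lintegral_of_independent_measurableSpace
      hle hX.comap_le hi hG1 (hl.comp (comap_measurable (X (k + 1))))
    refine h2.trans ?_
    rw [← M.map_X_pathLaw j Q (k + 1), lintegral_map hl hX]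
    rfl
  simp only [e1, e2]
  rw [lintegral_add_right _ (hG2'.mul_const _), lintegral_add_right _ (hG2'.mul_const _), hprod,
    lintegral_mul_const _ hG1']

/-- Integrating out `Z_{k+1}` on `Λ ≤ k + 1`. -/
theorem Adapted.lintegral_obs_succ_Lam (hμ : Adapted μ) {k : ℕ} {G : Path → ℝ≥0∞}
    (hG : Measurable[fullInfo μ k] G) {h : ℝ ⊕ Unit → ℝ≥0∞} (hh : Measurable h) :
    ∫⁻ ω in {ω | Lam ω ≤ k + 1}, G ω * h (obs μ (k + 1) ω) ∂M.law =
      ∫⁻ ω in {ω | Lam ω ≤ k + 1},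
        G ω * (if μ (k + 1) ω then ∫⁻ x, h (Sum.inl x) ∂M.law1 else h (Sum.inr ())) ∂M.law := by
  have hL := measurableSet_Lam fun i => i ≤ k + 1
  have key : ∀ (f : Path → ℝ≥0∞), ∫⁻ ω in {ω | Lam ω ≤ k + 1}, f ω ∂M.law =
      ∑' j, ENNReal.ofReal (M.prior j) * if j ≤ k + 1 then ∫⁻ ω, f ω ∂M.condLaw j else 0 := by
    intro f
    rw [← lintegral_indicator hL, lintegral_law]
    refine tsum_congr fun j => ?_
    congr 1
    split_ifs with hj
    · refine lintegral_congr_ae ?_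
      filter_upwards [M.Lam_condLaw j] with ω hω
      rw [Set.indicator_of_mem]
      simpa [hω] using hj
    · rw [lintegral_eq_zero_of_ae_eq_zero]
      filter_upwards [M.Lam_condLaw j] with ω hω
      rw [Set.indicator_of_notMem]
      · rfl
      · simpa [hω] using hj
  rw [key, key]
  refine tsum_congr fun j => ?_
  congr 1
  split_ifs with hj
  · rw [condLaw_eq_pathLaw, hμ.lintegral_obs_succ M _ _ hG hh]
    simp only [if_neg (not_lt.2 hj)]
  · rfl

theorem condLaw_eq_nullLaw {j k : ℕ} (h : k < j) {F : Set Path}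
    (hF : MeasurableSet[MeasurableSpace.comap (sampleMap k) inferInstance] F) :
    M.condLaw j F = M.nullLaw F := by
  obtain ⟨S, hS, rfl⟩ := hF
  rw [← Measure.map_apply (measurable_sampleMap k) hS, M.map_sampleMap_condLaw h,
    Measure.map_apply (measurable_sampleMap k) hS]

theorem pathLaw_preimage_nu (j : ℕ) (Q : ℕ → Measure ℝ) [∀ i, IsProbabilityMeasure (Q i)]
    {S : Set (ℕ → ℕ)} (hS : MeasurableSet S) :
    M.pathLaw j Q ((fun ω : Path => ω.2.2) ⁻¹' S) =
      Measure.infinitePi (fun _ : ℕ => M.p.toMeasure) S := by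
  rw [← Measure.map_apply (by fun_prop) hS]
  have : (fun ω : Path => ω.2.2) = Prod.snd ∘ (Prod.snd : Path → _) := rfl
  rw [this, ← Measure.map_map (by fun_prop) (by fun_prop), pathLaw, Measure.map_snd_prod,
    measure_univ, one_smul, Measure.map_snd_prod, measure_univ, one_smul]

theorem law_inter_Lam_eq {k : ℕ} {F : Set Path}
    (hF : MeasurableSet[MeasurableSpace.comap (sampleMap k) inferInstance] F) :
    M.law (F ∩ {ω | Lam ω = k + 1}) = ENNReal.ofReal (M.prior (k + 1)) * M.nullLaw F := by
  have hF' := (measurable_sampleMap k).comap_le F hF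
  rw [law_apply _ (hF'.inter (measurableSet_Lam fun i => i = k + 1)), tsum_eq_single (k + 1)]
  · rw [M.condLaw_inter_Lam (k + 1) (fun i => i = k + 1), if_pos rfl,
      M.condLaw_eq_nullLaw (Nat.lt_succ_self k) hF]
  · intro j hj
    rw [M.condLaw_inter_Lam j (fun i => i = k + 1), if_neg hj, mul_zero]

theorem tsum_prior_gt (k : ℕ) :
    ∑' j, (if k < j then ENNReal.ofReal (M.prior j) else 0) = ENNReal.ofReal (M.priorTail k) := by
  have h0 : HasSum (fun j => if k < j then M.prior j else 0) (M.priorTail k) := by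
    rw [← hasSum_nat_add_iff' (k + 1), Finset.sum_eq_zero, sub_zero]
    · convert! M.hasSum_prior_tail k using 2 with i
      rw [if_pos (by omega), add_comm i]
    · intro j hj
      rw [Finset.mem_range] at hj
      rw [if_neg (by omega)]
  rw [← h0.tsum_eq, ENNReal.ofReal_tsum_of_nonneg _ h0.summable]
  · refine tsum_congr fun j => ?_
    split_ifs <;> simp
  · intro j
    split_ifs
    · exact M.prior_nonneg j
    · exact le_rfl

theorem law_inter_Lam_gt {k : ℕ} {F : Set Path}
    (hF : MeasurableSet[MeasurableSpace.comap (sampleMap k) inferInstance] F) :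
    M.law (F ∩ {ω | k < Lam ω}) = ENNReal.ofReal (M.priorTail k) * M.nullLaw F := by
  have hF' := (measurable_sampleMap k).comap_le F hF
  rw [law_apply _ (hF'.inter (measurableSet_Lam fun i => k < i)), ← tsum_prior_gt,
    ← ENNReal.tsum_mul_right]
  refine tsum_congr fun j => ?_
  rw [M.condLaw_inter_Lam j (fun i => k < i)]
  split_ifs with hj
  · rw [M.condLaw_eq_nullLaw hj hF]
  · rw [mul_zero, zero_mul]

/-- The density of `P(Λ ≤ k, ·)` with respect to the null law on the information up to slot `k`. -/
def changedDensity (μ : ℕ → Path → Bool) : ℕ → Path → ℝ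
  | 0, _ => M.π₀
  | k + 1, ω => (changedDensity μ k ω + M.prior (k + 1)) * M.obsLR (obs μ (k + 1) ω)

theorem changedDensity_nonneg (μ : ℕ → Path → Bool) (k : ℕ) (ω : Path) :
    0 ≤ M.changedDensity μ k ω := by
  induction k with
  | zero => exact M.π₀_nonneg
  | succ k ih => exact mul_nonneg (add_nonneg ih (M.prior_nonneg _)) (M.obsLR_nonneg _)

theorem measurable_changedDensity (μ : ℕ → Path → Bool) (k : ℕ) :
    Measurable[obsInfo μ k] (M.changedDensity μ k) := by
  induction k with
  | zero => exact measurable_const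
  | succ k ih =>
    have h1 : Measurable[obsInfo μ (k + 1)] (M.changedDensity μ k) :=
      ih.mono (obsInfo_mono μ (Nat.le_succ k)) le_rfl
    have h2 : Measurable[obsInfo μ (k + 1)] (obs μ (k + 1)) :=
      (comap_measurable _).mono (comap_obs_le_obsInfo μ (by omega) le_rfl) le_rfl
    have h3 := M.measurable_obsLR.comp h2
    exact (h1.add_const _).mul h3

theorem law_inter_Lam_le_succ_of {k : ℕ} {s : Set Path}
    (hs : MeasurableSet[MeasurableSpace.comap (sampleMap k) inferInstance] s)
    (h : M.law (s ∩ {ω | Lam ω ≤ k}) =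
      ∫⁻ ω in s, ENNReal.ofReal (M.changedDensity μ k ω) ∂M.nullLaw) :
    M.law (s ∩ {ω | Lam ω ≤ k + 1}) =
      ∫⁻ ω in s, ENNReal.ofReal (M.changedDensity μ k ω + M.prior (k + 1)) ∂M.nullLaw := by
  have hs' := (measurable_sampleMap k).comap_le s hs
  have hset : s ∩ {ω | Lam ω ≤ k + 1} =
      (s ∩ {ω | Lam ω ≤ k}) ∪ (s ∩ {ω | Lam ω = k + 1}) := by
    ext ω
    simp only [Set.mem_inter_iff, Set.mem_ofPred_eq, Set.mem_union]
    constructor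
    · rintro ⟨h1, h2⟩
      rcases Nat.le_succ_iff.1 h2 with h3 | h3
      · exact Or.inl ⟨h1, h3⟩
      · exact Or.inr ⟨h1, h3⟩
    · rintro (⟨h1, h2⟩ | ⟨h1, h2⟩) <;> exact ⟨h1, by omega⟩
  have hdis : Disjoint (s ∩ {ω | Lam ω ≤ k}) (s ∩ {ω | Lam ω = k + 1}) := by
    rw [Set.disjoint_left]
    rintro ω ⟨_, h2⟩ ⟨_, h3⟩
    simp only [Set.mem_ofPred_eq] at h2 h3
    omega
  rw [hset, measure_union hdis (hs'.inter (measurableSet_Lam fun i => i = k + 1)),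
    h, M.law_inter_Lam_eq hs]
  simp only [ENNReal.ofReal_add (M.changedDensity_nonneg μ k _) (M.prior_nonneg (k + 1))]
  rw [lintegral_add_right _ measurable_const, setLIntegral_const]

theorem Adapted.law_inter_Lam_le (hD : M.klD ≠ ⊤) (hμ : Adapted μ) {k : ℕ} {F : Set Path}
    (hF : MeasurableSet[fullInfo μ k] F) :
    M.law (F ∩ {ω | Lam ω ≤ k}) =
      ∫⁻ ω in F, ENNReal.ofReal (M.changedDensity μ k ω) ∂M.nullLaw := by
  induction k generalizing F with
  | zero =>
    have h0 : fullInfo μ 0 = MeasurableSpace.comap (fun ω : Path => ω.2.2) inferInstance := by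
      refine le_antisymm (sup_le (iSup₂_le fun i hi => by simp at hi) le_rfl) le_sup_right
    have hF' := hμ.fullInfo_le_univ 0 _ hF
    rw [h0] at hF
    obtain ⟨S, hS, rfl⟩ := hF
    rw [law_apply _ (hF'.inter (measurableSet_Lam fun i => i ≤ 0)), tsum_eq_single 0]
    · rw [M.condLaw_inter_Lam 0 (fun i => i ≤ 0), if_pos le_rfl, condLaw_eq_pathLaw,
        M.pathLaw_preimage_nu _ _ hS]
      simp only [changedDensity, setLIntegral_const]
      rw [nullLaw, M.pathLaw_preimage_nu _ _ hS, prior, if_pos rfl]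
    · intro j hj
      rw [M.condLaw_inter_Lam j (fun i => i ≤ 0), if_neg (by omega), mul_zero]
  | succ k ih =>
    have hle := hμ.fullInfo_le_univ k
    have hLR : Measurable fun z => ENNReal.ofReal (M.obsLR z) :=
      M.measurable_obsLR.ennreal_ofReal
    have hobs : Measurable (obs μ (k + 1)) :=
      ((comap_measurable _).mono (comap_obs_le_obsInfo μ (by omega) le_rfl) le_rfl).mono
        (hμ.obsInfo_le_univ (k + 1)) le_rfl
    have hF0 := hμ.fullInfo_le_univ (k + 1) _ hF
    have hint : ∀ G : Path → ℝ≥0∞, Measurable[fullInfo μ k] G →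
        ∫⁻ ω in {ω | Lam ω ≤ k + 1}, G ω ∂M.law =
          ∫⁻ ω, ENNReal.ofReal (M.changedDensity μ k ω + M.prior (k + 1)) * G ω ∂M.nullLaw := by
      intro G hG
      have hS : Measurable fun ω =>
          ENNReal.ofReal (M.changedDensity μ k ω + M.prior (k + 1)) :=
        (((M.measurable_changedDensity μ k).mono (hμ.obsInfo_le_univ _) le_rfl).add_const
          _).ennreal_ofReal
      have hw := lintegral_withDensity_eq_lintegral_mul M.nullLaw hS (hG.mono hle le_rfl)
      refine Eq.trans (lintegral_congr_of_measurableSet hle (fun s hs => ?_) hG) hw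
      rw [Measure.restrict_apply (hle _ hs), withDensity_apply _ (hle _ hs)]
      exact M.law_inter_Lam_le_succ_of (hμ.fullInfo_le k _ hs) (ih hs)
    rw [← Measure.restrict_apply hF0, ← withDensity_apply _ hF0]
    rw [fullInfo_succ] at hF
    refine Measure.apply_eq_of_sup hle hobs.comap_le ?_ hF
    rintro s _ hs ⟨B, hB, rfl⟩
    have hsm := hle _ hs
    have hBm := hobs hB
    have hone : Measurable (B.indicator (1 : ℝ ⊕ Unit → ℝ≥0∞)) := measurable_one.indicator hB
    rw [Measure.restrict_apply (hsm.inter hBm), withDensity_apply _ (hsm.inter hBm)]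
    have hG : Measurable[fullInfo μ k] (s.indicator (1 : Path → ℝ≥0∞)) :=
      (measurable_const (a := (1 : ℝ≥0∞))).indicator hs
    have hG2 : Measurable[fullInfo μ k] fun ω =>
        ENNReal.ofReal (M.changedDensity μ k ω + M.prior (k + 1)) * s.indicator 1 ω :=
      (((M.measurable_changedDensity μ k).mono le_sup_left le_rfl).add_const
          _).ennreal_ofReal.mul hG
    have hκ : Measurable[fullInfo μ k] fun ω => s.indicator (1 : Path → ℝ≥0∞) ω *
        (if μ (k + 1) ω then ∫⁻ x, B.indicator 1 (Sum.inl x) ∂M.law1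
          else B.indicator 1 (Sum.inr ())) :=
      hG.mul (Measurable.ite (hμ.measurable_fullInfo k (measurableSet_singleton true))
        measurable_const measurable_const)
    have hlhs : M.law (s ∩ obs μ (k + 1) ⁻¹' B ∩ {ω | Lam ω ≤ k + 1}) =
        ∫⁻ ω in {ω | Lam ω ≤ k + 1}, s.indicator (1 : Path → ℝ≥0∞) ω *
          B.indicator 1 (obs μ (k + 1) ω) ∂M.law := by
      rw [← Measure.restrict_apply (hsm.inter hBm), ← lintegral_indicator_one (hsm.inter hBm)]
      refine lintegral_congr fun ω => ?_
      by_cases h1 : ω ∈ s <;> by_cases h2 : obs μ (k + 1) ω ∈ B <;> simp [h1, h2]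
    have hrhs : ∫⁻ ω in s ∩ obs μ (k + 1) ⁻¹' B,
          ENNReal.ofReal (M.changedDensity μ (k + 1) ω) ∂M.nullLaw =
        ∫⁻ ω, ENNReal.ofReal (M.changedDensity μ k ω + M.prior (k + 1)) * s.indicator 1 ω *
          (ENNReal.ofReal (M.obsLR (obs μ (k + 1) ω)) * B.indicator 1 (obs μ (k + 1) ω))
          ∂M.nullLaw := by
      rw [← lintegral_indicator (hsm.inter hBm)]
      refine lintegral_congr fun ω => ?_
      have hmul : ENNReal.ofReal (M.changedDensity μ (k + 1) ω) =
          ENNReal.ofReal (M.changedDensity μ k ω + M.prior (k + 1)) *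
            ENNReal.ofReal (M.obsLR (obs μ (k + 1) ω)) :=
        ENNReal.ofReal_mul (add_nonneg (M.changedDensity_nonneg μ k ω) (M.prior_nonneg _))
      by_cases h1 : ω ∈ s <;> by_cases h2 : obs μ (k + 1) ω ∈ B <;> simp [h1, h2, hmul]
    rw [hlhs, hrhs, hμ.lintegral_obs_succ_Lam M hG hone, hint _ hκ, nullLaw,
      hμ.lintegral_obs_succ M _ _ hG2
        (h := fun z => ENNReal.ofReal (M.obsLR z) * B.indicator 1 z) (hLR.mul hone)]
    refine lintegral_congr fun ω => ?_
    rw [mul_assoc]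
    congr 2
    have h1 : ∫⁻ x, B.indicator (1 : ℝ ⊕ Unit → ℝ≥0∞) (Sum.inl x) ∂M.law1 =
        ∫⁻ x, ENNReal.ofReal (M.obsLR (Sum.inl x)) * B.indicator 1 (Sum.inl x) ∂M.law0 := by
      rw [M.law1_eq_withDensity hD]
      exact lintegral_withDensity_eq_lintegral_mul _
        M.measurable_lr.ennreal_ofReal (hone.comp measurable_inl)
    rw [h1]
    simp [obsLR]

end ChangeModel

namespace ChangeModel

variable (M : ChangeModel) {μ : ℕ → Path → Bool}

theorem Adapted.law_inter_Lam_le_succ (hD : M.klD ≠ ⊤) (hμ : Adapted μ) {k : ℕ} {F : Set Path}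
    (hF : MeasurableSet[fullInfo μ k] F) :
    M.law (F ∩ {ω | Lam ω ≤ k + 1}) =
      ∫⁻ ω in F, ENNReal.ofReal (M.changedDensity μ k ω + M.prior (k + 1)) ∂M.nullLaw :=
  M.law_inter_Lam_le_succ_of (hμ.fullInfo_le k _ hF) (hμ.law_inter_Lam_le M hD hF)

/-- The density of `P` with respect to the null law on the information up to slot `k`. -/
def density (μ : ℕ → Path → Bool) (k : ℕ) (ω : Path) : ℝ :=
  M.changedDensity μ k ω + M.priorTail k

theorem density_pos (μ : ℕ → Path → Bool) (k : ℕ) (ω : Path) : 0 < M.density μ k ω :=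
  add_pos_of_nonneg_of_pos (M.changedDensity_nonneg μ k ω) (M.priorTail_pos k)

theorem measurable_density (μ : ℕ → Path → Bool) (k : ℕ) :
    Measurable[obsInfo μ k] (M.density μ k) :=
  (M.measurable_changedDensity μ k).add_const _

theorem Adapted.law_eq_setLIntegral (hD : M.klD ≠ ⊤) (hμ : Adapted μ) {k : ℕ} {F : Set Path}
    (hF : MeasurableSet[fullInfo μ k] F) :
    M.law F = ∫⁻ ω in F, ENNReal.ofReal (M.density μ k ω) ∂M.nullLaw := by
  have hF' := hμ.fullInfo_le_univ k _ hF
  have hc : F ∩ {ω | k < Lam ω} = F \ {ω | Lam ω ≤ k} := by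
    ext ω; simp
  rw [← measure_inter_add_sdiff F (measurableSet_Lam fun i => i ≤ k), ← hc,
    hμ.law_inter_Lam_le M hD hF, M.law_inter_Lam_gt (hμ.fullInfo_le k _ hF)]
  simp only [density, ENNReal.ofReal_add (M.changedDensity_nonneg μ k _) (M.priorTail_pos k).le]
  rw [lintegral_add_right _ measurable_const, setLIntegral_const]

theorem Adapted.lintegral_law_eq (hD : M.klD ≠ ⊤) (hμ : Adapted μ) {k : ℕ} {G : Path → ℝ≥0∞}
    (hG : Measurable[fullInfo μ k] G) :
    ∫⁻ ω, G ω ∂M.law = ∫⁻ ω, ENNReal.ofReal (M.density μ k ω) * G ω ∂M.nullLaw := by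
  have hle := hμ.fullInfo_le_univ k
  have hS : Measurable fun ω => ENNReal.ofReal (M.density μ k ω) :=
    ((M.measurable_density μ k).mono (hμ.obsInfo_le_univ k) le_rfl).ennreal_ofReal
  have hw := lintegral_withDensity_eq_lintegral_mul M.nullLaw hS (hG.mono hle le_rfl)
  refine Eq.trans (lintegral_congr_of_measurableSet hle (fun s hs => ?_) hG) hw
  rw [withDensity_apply _ (hle _ hs)]
  exact hμ.law_eq_setLIntegral M hD hs

theorem Adapted.setLIntegral_law_eq (hD : M.klD ≠ ⊤) (hμ : Adapted μ) {k : ℕ} {F : Set Path}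
    (hF : MeasurableSet[fullInfo μ k] F) {G : Path → ℝ≥0∞} (hG : Measurable[fullInfo μ k] G) :
    ∫⁻ ω in F, G ω ∂M.law =
      ∫⁻ ω in F, ENNReal.ofReal (M.density μ k ω) * G ω ∂M.nullLaw := by
  have hF' := hμ.fullInfo_le_univ k _ hF
  rw [← lintegral_indicator hF', ← lintegral_indicator hF',
    hμ.lintegral_law_eq M hD (hG.indicator hF)]
  refine lintegral_congr fun ω => ?_
  by_cases h : ω ∈ F <;> simp [h]

/-- The posterior probability of `Λ > k`. -/
def notChanged (μ : ℕ → Path → Bool) (k : ℕ) (ω : Path) : ℝ :=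
  M.priorTail k / M.density μ k ω

theorem notChanged_pos (μ : ℕ → Path → Bool) (k : ℕ) (ω : Path) : 0 < M.notChanged μ k ω :=
  div_pos (M.priorTail_pos k) (M.density_pos μ k ω)

theorem notChanged_le_one (μ : ℕ → Path → Bool) (k : ℕ) (ω : Path) :
    M.notChanged μ k ω ≤ 1 :=
  (div_le_one (M.density_pos μ k ω)).2 (le_add_of_nonneg_left (M.changedDensity_nonneg μ k ω))

theorem measurable_notChanged (μ : ℕ → Path → Bool) (k : ℕ) :
    Measurable[obsInfo μ k] (M.notChanged μ k) :=
  measurable_const.div (M.measurable_density μ k)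

theorem Adapted.law_inter_Lam_gt_eq (hD : M.klD ≠ ⊤) (hμ : Adapted μ) {k : ℕ} {F : Set Path}
    (hF : MeasurableSet[fullInfo μ k] F) :
    M.law (F ∩ {ω | k < Lam ω}) = ∫⁻ ω in F, ENNReal.ofReal (M.notChanged μ k ω) ∂M.law := by
  rw [M.law_inter_Lam_gt (hμ.fullInfo_le k _ hF), hμ.setLIntegral_law_eq M hD hF
    ((M.measurable_notChanged μ k).mono le_sup_left le_rfl).ennreal_ofReal, ← setLIntegral_const]
  refine lintegral_congr fun ω => ?_
  rw [← ENNReal.ofReal_mul (M.density_pos μ k ω).le, notChanged,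
    mul_div_cancel₀ _ (M.density_pos μ k ω).ne']

theorem Adapted.posterior_ae_eq (hD : M.klD ≠ ⊤) (hμ : Adapted μ) (k : ℕ) :
    M.posterior μ k =ᵐ[M.law] fun ω => 1 - M.notChanged μ k ω := by
  have hle := hμ.obsInfo_le_univ k
  have hmeas := M.measurable_notChanged μ k
  have hL := measurableSet_Lam fun i => i ≤ k
  have hint : Integrable (M.notChanged μ k) M.law := by
    refine Integrable.of_bound (hmeas.mono hle le_rfl).aestronglyMeasurable 1
      (Eventually.of_forall fun ω => ?_)
    rw [Real.norm_of_nonneg (M.notChanged_pos μ k ω).le]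
    exact M.notChanged_le_one μ k ω
  symm
  refine ae_eq_condExp_of_forall_setIntegral_eq hle ((integrable_const _).indicator hL)
    (fun s _ _ => ((integrable_const _).sub hint).integrableOn) (fun s hs _ => ?_)
    (measurable_const.sub hmeas).stronglyMeasurable.aestronglyMeasurable
  have hs' := hle _ hs
  have h1 := hμ.law_inter_Lam_gt_eq M hD
    ((le_sup_left : obsInfo μ k ≤ fullInfo μ k) s hs)
  have h2 : ∫ ω in s, M.notChanged μ k ω ∂M.law = M.law.real (s ∩ {ω | k < Lam ω}) := by
    rw [integral_eq_lintegral_of_nonneg_ae (Eventually.of_forall fun ω =>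
      (M.notChanged_pos μ k ω).le) (hmeas.mono hle le_rfl).aestronglyMeasurable, ← h1]
    rfl
  rw [integral_sub (integrable_const _).integrableOn hint.integrableOn, h2,
    setIntegral_indicator hL]
  have hc : s ∩ {ω | k < Lam ω} = s \ {ω | Lam ω ≤ k} := by
    ext ω; simp
  have h3 := measureReal_inter_add_sdiff (μ := M.law) (s := s) hL
  rw [hc]
  simp only [integral_const, smul_eq_mul, mul_one, measureReal_restrict_apply_univ]
  linarith

theorem density_succ (μ : ℕ → Path → Bool) (k : ℕ) (ω : Path) :
    M.density μ (k + 1) ω = (M.changedDensity μ k ω + M.prior (k + 1)) *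
      M.obsLR (obs μ (k + 1) ω) + (1 - M.ρ) * M.priorTail k := by
  rw [density, priorTail_succ]; rfl

/-- The conditional probability of `Λ ≤ k + 1` given the information up to slot `k`. -/
def changedNext (μ : ℕ → Path → Bool) (k : ℕ) (ω : Path) : ℝ :=
  (M.changedDensity μ k ω + M.prior (k + 1)) / M.density μ k ω

theorem changedNext_nonneg (μ : ℕ → Path → Bool) (k : ℕ) (ω : Path) :
    0 ≤ M.changedNext μ k ω :=
  div_nonneg (add_nonneg (M.changedDensity_nonneg μ k ω) (M.prior_nonneg _))
    (M.density_pos μ k ω).le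

theorem one_sub_changedNext (μ : ℕ → Path → Bool) (k : ℕ) (ω : Path) :
    1 - M.changedNext μ k ω = (1 - M.ρ) * M.notChanged μ k ω := by
  have := M.density_pos μ k ω
  rw [changedNext, notChanged, prior_succ]
  field_simp
  rw [density]; ring

theorem changedNext_lt_one (μ : ℕ → Path → Bool) (k : ℕ) (ω : Path) :
    M.changedNext μ k ω < 1 := by
  have h := M.one_sub_changedNext μ k ω
  have : 0 < (1 - M.ρ) * M.notChanged μ k ω :=
    mul_pos (by linarith [M.ρ_lt_one]) (M.notChanged_pos μ k ω)
  linarith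

theorem measurable_changedNext (μ : ℕ → Path → Bool) (k : ℕ) :
    Measurable[obsInfo μ k] (M.changedNext μ k) :=
  ((M.measurable_changedDensity μ k).add_const _).div (M.measurable_density μ k)

theorem Adapted.law_inter_Lam_le_succ_eq (hD : M.klD ≠ ⊤) (hμ : Adapted μ) {k : ℕ}
    {F : Set Path} (hF : MeasurableSet[fullInfo μ k] F) :
    M.law (F ∩ {ω | Lam ω ≤ k + 1}) =
      ∫⁻ ω in F, ENNReal.ofReal (M.changedNext μ k ω) ∂M.law := by
  rw [hμ.law_inter_Lam_le_succ M hD hF, hμ.setLIntegral_law_eq M hD hF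
    ((M.measurable_changedNext μ k).mono le_sup_left le_rfl).ennreal_ofReal]
  refine lintegral_congr fun ω => ?_
  rw [← ENNReal.ofReal_mul (M.density_pos μ k ω).le, changedNext,
    mul_div_cancel₀ _ (M.density_pos μ k ω).ne']

/-- The one-step likelihood ratio of the observations. -/
def stepLR (μ : ℕ → Path → Bool) (k : ℕ) (ω : Path) : ℝ :=
  1 - M.changedNext μ k ω + M.changedNext μ k ω * M.obsLR (obs μ (k + 1) ω)

theorem stepLR_pos (μ : ℕ → Path → Bool) (k : ℕ) (ω : Path) : 0 < M.stepLR μ k ω := by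
  have h1 := M.changedNext_lt_one μ k ω
  have h2 := mul_nonneg (M.changedNext_nonneg μ k ω) (M.obsLR_nonneg (obs μ (k + 1) ω))
  unfold stepLR; linarith

theorem density_mul_stepLR (μ : ℕ → Path → Bool) (k : ℕ) (ω : Path) :
    M.density μ k ω * M.stepLR μ k ω = M.density μ (k + 1) ω := by
  have := M.density_pos μ k ω
  rw [stepLR, one_sub_changedNext, density_succ, notChanged, changedNext]
  field_simp
  ring

theorem neg_log_notChanged_succ (μ : ℕ → Path → Bool) (k : ℕ) (ω : Path) :
    -Real.log (M.notChanged μ (k + 1) ω) =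
      -Real.log (M.notChanged μ k ω) + |Real.log (1 - M.ρ)| + Real.log (M.stepLR μ k ω) := by
  have h1 : 0 < 1 - M.ρ := by linarith [M.ρ_lt_one]
  have h2 : Real.log (1 - M.ρ) ≤ 0 := Real.log_nonpos h1.le (by linarith [M.ρ_pos])
  have h3 : M.notChanged μ (k + 1) ω = (1 - M.ρ) * M.notChanged μ k ω / M.stepLR μ k ω := by
    have := M.density_pos μ k ω
    have := M.stepLR_pos μ k ω
    rw [notChanged, ← density_mul_stepLR, priorTail_succ, notChanged]
    field_simp
  rw [h3, Real.log_div (mul_pos h1 (M.notChanged_pos μ k ω)).ne' (M.stepLR_pos μ k ω).ne',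
    Real.log_mul h1.ne' (M.notChanged_pos μ k ω).ne', abs_of_nonpos h2]
  ring

theorem neg_log_notChanged_nonneg (μ : ℕ → Path → Bool) (k : ℕ) (ω : Path) :
    0 ≤ -Real.log (M.notChanged μ k ω) :=
  neg_nonneg.2 (Real.log_nonpos (M.notChanged_pos μ k ω).le (M.notChanged_le_one μ k ω))

theorem klFun_stepLR_le (μ : ℕ → Path → Bool) (k : ℕ) (ω : Path) :
    InformationTheory.klFun (M.stepLR μ k ω) ≤
      M.changedNext μ k ω * InformationTheory.klFun (M.obsLR (obs μ (k + 1) ω)) := by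
  have h := InformationTheory.convexOn_klFun.2 (Set.mem_Ici.2 zero_le_one)
    (Set.mem_Ici.2 (M.obsLR_nonneg (obs μ (k + 1) ω)))
    (sub_nonneg.2 (M.changedNext_lt_one μ k ω).le) (M.changedNext_nonneg μ k ω) (by ring)
  simpa [InformationTheory.klFun_one, stepLR] using h

/-- The mean increase of `-log P(Λ > k | Z_1, …, Z_k)` in one slot. -/
theorem Adapted.lintegral_neg_log_notChanged_succ_le (hD : M.klD ≠ ⊤) (hμ : Adapted μ) {k : ℕ}
    {F : Set Path} (hF : MeasurableSet[fullInfo μ k] F) :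
    ∫⁻ ω in F, ENNReal.ofReal (-Real.log (M.notChanged μ (k + 1) ω)) ∂M.law ≤
      ∫⁻ ω in F, ENNReal.ofReal (-Real.log (M.notChanged μ k ω)) ∂M.law +
        ENNReal.ofReal |Real.log (1 - M.ρ)| * M.law F +
        M.klD * M.law (F ∩ {ω | μ (k + 1) ω = true} ∩ {ω | Lam ω ≤ k + 1}) := by
  have hle := hμ.fullInfo_le_univ k
  have hF' := hle _ hF
  have hF1 : MeasurableSet[fullInfo μ (k + 1)] F := fullInfo_mono μ (Nat.le_succ k) _ hF
  have hd : Measurable[fullInfo μ k] (M.density μ k) :=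
    (M.measurable_density μ k).mono le_sup_left le_rfl
  have hn : Measurable[fullInfo μ k] (M.notChanged μ k) :=
    (M.measurable_notChanged μ k).mono le_sup_left le_rfl
  have hn1 : Measurable[fullInfo μ (k + 1)] (M.notChanged μ (k + 1)) :=
    (M.measurable_notChanged μ (k + 1)).mono le_sup_left le_rfl
  have hq : Measurable[fullInfo μ k] (M.changedNext μ k) :=
    (M.measurable_changedNext μ k).mono le_sup_left le_rfl
  have hkl : Measurable fun z => ENNReal.ofReal (InformationTheory.klFun (M.obsLR z)) :=
    (InformationTheory.measurable_klFun.comp M.measurable_obsLR).ennreal_ofReal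
  have hS : MeasurableSet[fullInfo μ k] {ω | μ (k + 1) ω = true} :=
    hμ.measurable_fullInfo k (measurableSet_singleton true)
  have hd' := (hd.mono hle le_rfl)
  have hd1' : Measurable (M.density μ (k + 1)) :=
    (M.measurable_density μ (k + 1)).mono (hμ.obsInfo_le_univ (k + 1)) le_rfl
  set c : ℝ := |Real.log (1 - M.ρ)| with hc
  have ha : Measurable[fullInfo μ k] fun ω => -Real.log (M.notChanged μ k ω) + c :=
    (Real.measurable_log.comp hn).neg.add_const _
  have hb : Measurable[fullInfo μ (k + 1)] fun ω =>
      ENNReal.ofReal (-Real.log (M.notChanged μ (k + 1) ω)) :=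
    (Real.measurable_log.comp hn1).neg.ennreal_ofReal
  have hlaw1 : M.law F ≠ ⊤ := measure_ne_top _ _
  -- the information gain
  have hgain : ∫⁻ ω in F, ENNReal.ofReal (M.density μ k ω) *
      ENNReal.ofReal (InformationTheory.klFun (M.stepLR μ k ω)) ∂M.nullLaw ≤
      M.klD * M.law (F ∩ {ω | μ (k + 1) ω = true} ∩ {ω | Lam ω ≤ k + 1}) := by
    have hG : Measurable[fullInfo μ k] fun ω => F.indicator (fun ω =>
        ENNReal.ofReal (M.density μ k ω) * ENNReal.ofReal (M.changedNext μ k ω)) ω :=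
      (hd.ennreal_ofReal.mul hq.ennreal_ofReal).indicator hF
    calc _ ≤ ∫⁻ ω, F.indicator (fun ω =>
            ENNReal.ofReal (M.density μ k ω) * ENNReal.ofReal (M.changedNext μ k ω)) ω *
              ENNReal.ofReal (InformationTheory.klFun (M.obsLR (obs μ (k + 1) ω)))
              ∂M.nullLaw := by
          rw [← lintegral_indicator hF']
          refine lintegral_mono fun ω => ?_
          by_cases h : ω ∈ F
          · simp only [Set.indicator_of_mem h]
            rw [mul_assoc, ← ENNReal.ofReal_mul (M.changedNext_nonneg μ k ω)]
            gcongr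
            exact M.klFun_stepLR_le μ k ω
          · simp [h]
      _ = ∫⁻ ω, F.indicator (fun ω =>
            ENNReal.ofReal (M.density μ k ω) * ENNReal.ofReal (M.changedNext μ k ω)) ω *
            (if μ (k + 1) ω then M.klD else 0) ∂M.nullLaw := by
          rw [nullLaw, hμ.lintegral_obs_succ M _ _ hG hkl]
          refine lintegral_congr fun ω => ?_
          have h1 := M.klD_eq_lintegral hD
          simp only [obsLR, Sum.elim_inl, Sum.elim_inr, InformationTheory.klFun_one,
            ENNReal.ofReal_zero]
          rw [h1]
      _ = ∫⁻ ω in F ∩ {ω | μ (k + 1) ω = true}, ENNReal.ofReal (M.density μ k ω) *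
            ENNReal.ofReal (M.changedNext μ k ω) * M.klD ∂M.nullLaw := by
          rw [← lintegral_indicator (hF'.inter (hle _ hS))]
          refine lintegral_congr fun ω => ?_
          by_cases h1 : ω ∈ F <;> by_cases h2 : μ (k + 1) ω = true <;> simp [h1, h2]
      _ = _ := by
          have hm : Measurable fun ω =>
              ENNReal.ofReal (M.density μ k ω) * ENNReal.ofReal (M.changedNext μ k ω) :=
            hd'.ennreal_ofReal.mul (hq.mono hle le_rfl).ennreal_ofReal
          rw [lintegral_mul_const _ hm,
            ← hμ.setLIntegral_law_eq M hD (hF.inter hS) hq.ennreal_ofReal,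
            ← hμ.law_inter_Lam_le_succ_eq M hD (hF.inter hS), mul_comm]
  have hpoint : ∀ ω, ENNReal.ofReal (M.density μ (k + 1) ω) *
      ENNReal.ofReal (-Real.log (M.notChanged μ (k + 1) ω)) + ENNReal.ofReal (M.density μ k ω) =
      ENNReal.ofReal (M.density μ (k + 1) ω) *
        ENNReal.ofReal (-Real.log (M.notChanged μ k ω) + c) +
      ENNReal.ofReal (M.density μ k ω) *
        ENNReal.ofReal (InformationTheory.klFun (M.stepLR μ k ω)) +
      ENNReal.ofReal (M.density μ (k + 1) ω) := by
    intro ω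
    have p0 := (M.density_pos μ k ω).le
    have p1 := (M.density_pos μ (k + 1) ω).le
    have p2 := M.neg_log_notChanged_nonneg μ (k + 1) ω
    have p3 := M.neg_log_notChanged_nonneg μ k ω
    have p4 : 0 ≤ c := abs_nonneg _
    have p5 := InformationTheory.klFun_nonneg (M.stepLR_pos μ k ω).le
    rw [← ENNReal.ofReal_mul p1, ← ENNReal.ofReal_mul p1, ← ENNReal.ofReal_mul p0,
      ← ENNReal.ofReal_add (mul_nonneg p1 p2) p0,
      ← ENNReal.ofReal_add (mul_nonneg p1 (add_nonneg p3 p4)) (mul_nonneg p0 p5),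
      ← ENNReal.ofReal_add (add_nonneg (mul_nonneg p1 (add_nonneg p3 p4)) (mul_nonneg p0 p5)) p1]
    congr 1
    rw [neg_log_notChanged_succ, ← density_mul_stepLR, InformationTheory.klFun_apply]
    ring
  have hm : Measurable fun ω => ENNReal.ofReal (M.density μ (k + 1) ω) *
      ENNReal.ofReal (-Real.log (M.notChanged μ k ω) + c) :=
    hd1'.ennreal_ofReal.mul (ha.mono hle le_rfl).ennreal_ofReal
  have hsum := lintegral_congr (μ := M.nullLaw.restrict F) hpoint
  rw [lintegral_add_right _ hd'.ennreal_ofReal, lintegral_add_right _ hd1'.ennreal_ofReal,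
    lintegral_add_left hm,
    ← hμ.setLIntegral_law_eq M hD hF1 hb,
    ← hμ.law_eq_setLIntegral M hD hF, ← hμ.law_eq_setLIntegral M hD hF1,
    ← hμ.setLIntegral_law_eq M hD hF1
      (ha.mono (fullInfo_mono μ (Nat.le_succ k)) le_rfl).ennreal_ofReal,
    ENNReal.add_left_inj hlaw1] at hsum
  rw [hsum]
  refine add_le_add (le_of_eq ?_) hgain
  rw [← setLIntegral_const, ← lintegral_add_right _ measurable_const]
  refine lintegral_congr fun ω => ?_
  rw [ENNReal.ofReal_add (M.neg_log_notChanged_nonneg μ k ω) (abs_nonneg _)]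

end ChangeModel

namespace ChangeModel

variable (M : ChangeModel)

/-! ### The Markov chain of sampling rights under greedy sampling -/

/-- The next number of rights when `x` rights are left and `v` are collected. -/
def chainStep (x v : ℕ) : ℕ := min M.C (x + v - 1)

/-- The probability of sampling in slot `k + 1` when greedy sampling starts with `x` rights. -/
def sampleProb : ℕ → ℕ → ℝ
  | 0, x => ∫ v : ℕ, (if 1 ≤ x + v then 1 else 0 : ℝ) ∂M.p.toMeasure
  | k + 1, x => ∫ v : ℕ, sampleProb k (M.chainStep x v) ∂M.p.toMeasure

/-- The mean number of samples in `m` slots when greedy sampling starts with `x` rights. -/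
def sampleMean (m x : ℕ) : ℝ := ∑ k ∈ Finset.range m, M.sampleProb k x

theorem integrable_of_bounded {f : ℕ → ℝ} {c : ℝ} (h : ∀ v, |f v| ≤ c) :
    Integrable f M.p.toMeasure :=
  Integrable.of_bound (measurable_of_countable f).aestronglyMeasurable c (Eventually.of_forall h)

theorem sampleProb_mem (k x : ℕ) : 0 ≤ M.sampleProb k x ∧ M.sampleProb k x ≤ 1 := by
  induction k generalizing x with
  | zero =>
    refine ⟨integral_nonneg fun v => by dsimp only; split_ifs <;> simp, ?_⟩
    calc M.sampleProb 0 x ≤ ∫ _ : ℕ, (1 : ℝ) ∂M.p.toMeasure := by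
          refine integral_mono_of_nonneg (Eventually.of_forall fun v => ?_) (integrable_const _)
            (Eventually.of_forall fun v => ?_) <;> dsimp only <;> split_ifs <;> simp
      _ = 1 := by simp
  | succ k ih =>
    refine ⟨integral_nonneg fun v => (ih _).1, ?_⟩
    calc M.sampleProb (k + 1) x ≤ ∫ _ : ℕ, (1 : ℝ) ∂M.p.toMeasure :=
          integral_mono_of_nonneg (Eventually.of_forall fun v => (ih _).1) (integrable_const _)
            (Eventually.of_forall fun v => (ih _).2)
      _ = 1 := by simp

theorem integrable_sampleProb (k : ℕ) (g : ℕ → ℕ) :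
    Integrable (fun v => M.sampleProb k (g v)) M.p.toMeasure :=
  M.integrable_of_bounded (c := 1) fun v => by
    rw [abs_of_nonneg (M.sampleProb_mem k _).1]; exact (M.sampleProb_mem k _).2

theorem integrable_ite (x : ℕ) :
    Integrable (fun v : ℕ => (if 1 ≤ x + v then 1 else 0 : ℝ)) M.p.toMeasure :=
  M.integrable_of_bounded (c := 1) fun v => by split_ifs <;> simp

theorem sampleProb_mono (k : ℕ) : Monotone (M.sampleProb k) := by
  induction k with
  | zero =>
    intro x y hxy
    refine integral_mono (M.integrable_ite x) (M.integrable_ite y) fun v => ?_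
    dsimp only
    split_ifs
    · exact le_rfl
    · omega
    · exact zero_le_one
    · exact le_rfl
  | succ k ih =>
    intro x y hxy
    refine integral_mono (M.integrable_sampleProb k _) (M.integrable_sampleProb k _) fun v => ?_
    exact ih (min_le_min le_rfl (by omega))

theorem sampleProb_zero_mono : Monotone fun k => M.sampleProb k 0 := by
  refine monotone_nat_of_le_succ fun k => ?_
  calc M.sampleProb k 0 = ∫ _ : ℕ, M.sampleProb k 0 ∂M.p.toMeasure := by simp
    _ ≤ M.sampleProb (k + 1) 0 :=
      integral_mono (integrable_const _) (M.integrable_sampleProb k _) fun v =>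
        M.sampleProb_mono k (Nat.zero_le _)

theorem integrable_sampleMean (m : ℕ) (g : ℕ → ℕ) :
    Integrable (fun v => M.sampleMean m (g v)) M.p.toMeasure :=
  integrable_finsetSum _ fun k _ => M.integrable_sampleProb k g

theorem sampleMean_mono (m : ℕ) : Monotone (M.sampleMean m) := fun _ _ h =>
  Finset.sum_le_sum fun k _ => M.sampleProb_mono k h

theorem sampleMean_succ (m x : ℕ) :
    M.sampleMean (m + 1) x =
      ∫ v : ℕ, ((if 1 ≤ x + v then 1 else 0 : ℝ) + M.sampleMean m (M.chainStep x v))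
        ∂M.p.toMeasure := by
  rw [integral_add (M.integrable_ite x) (M.integrable_sampleMean m _), sampleMean,
    Finset.sum_range_succ', add_comm]
  congr 1
  unfold sampleMean
  rw [integral_finsetSum _ fun k _ => M.integrable_sampleProb k _]
  rfl

theorem sampleMean_succ_le (m x : ℕ) : M.sampleMean m (x + 1) ≤ M.sampleMean m x + 1 := by
  induction m generalizing x with
  | zero => simp [sampleMean]
  | succ m ih =>
    have hi : ∀ x, Integrable (fun v : ℕ => (if 1 ≤ x + v then 1 else 0 : ℝ) +
        M.sampleMean m (M.chainStep x v)) M.p.toMeasure := fun x =>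
      (M.integrable_ite x).add (M.integrable_sampleMean m _)
    have h1 : M.sampleMean (m + 1) x + 1 = ∫ v : ℕ, (((if 1 ≤ x + v then 1 else 0 : ℝ) +
        M.sampleMean m (M.chainStep x v)) + 1) ∂M.p.toMeasure := by
      rw [integral_add (hi x) (integrable_const _), ← sampleMean_succ]; simp
    rw [h1, sampleMean_succ]
    refine integral_mono (hi _) ((hi x).add (integrable_const _)) fun v => ?_
    dsimp only
    rw [if_pos (by omega)]
    split_ifs with h
    · have hle : M.chainStep (x + 1) v ≤ M.chainStep x v + 1 := by
        unfold chainStep; omega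
      have := (M.sampleMean_mono m hle).trans (ih _)
      linarith
    · have : M.chainStep (x + 1) v = M.chainStep x v := by
        unfold chainStep; congr 1; omega
      rw [this]; linarith

theorem sampleMean_le_add (m x : ℕ) : M.sampleMean m x ≤ M.sampleMean m 0 + x := by
  induction x with
  | zero => simp
  | succ x ih =>
    have := M.sampleMean_succ_le m x
    push_cast; linarith

theorem summable_sampleProb_sub (x : ℕ) :
    Summable fun k => M.sampleProb k x - M.sampleProb k 0 := by
  refine summable_of_sum_range_le (c := x)
    (fun k => sub_nonneg.2 (M.sampleProb_mono k (Nat.zero_le x))) fun m => ?_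
  rw [Finset.sum_sub_distrib]
  have := M.sampleMean_le_add m x
  unfold sampleMean at this; linarith

/-- The long-run sampling probability of the chain. -/
def chainLimit : ℝ := ⨆ k, M.sampleProb k 0

theorem tendsto_sampleProb_zero :
    Tendsto (fun k => M.sampleProb k 0) atTop (𝓝 M.chainLimit) :=
  tendsto_atTop_ciSup M.sampleProb_zero_mono
    ⟨1, by rintro _ ⟨k, rfl⟩; exact (M.sampleProb_mem k 0).2⟩

theorem tendsto_sampleProb (x : ℕ) :
    Tendsto (fun k => M.sampleProb k x) atTop (𝓝 M.chainLimit) := by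
  have h := (M.summable_sampleProb_sub x).tendsto_atTop_zero.add M.tendsto_sampleProb_zero
  simpa using h

theorem chainLimit_nonneg : 0 ≤ M.chainLimit :=
  ge_of_tendsto' M.tendsto_sampleProb_zero fun k => (M.sampleProb_mem k 0).1

/-- The relative value of `x` sampling rights. -/
def relValue (x : ℕ) : ℝ := ∑' k, (M.sampleProb k x - M.sampleProb k 0)

theorem tendsto_relValue (x : ℕ) :
    Tendsto (fun m => M.sampleMean m x - M.sampleMean m 0) atTop (𝓝 (M.relValue x)) := by
  have h := (M.summable_sampleProb_sub x).hasSum.tendsto_sum_nat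
  simp only [Finset.sum_sub_distrib] at h
  exact h

theorem relValue_nonneg (x : ℕ) : 0 ≤ M.relValue x :=
  ge_of_tendsto' (M.tendsto_relValue x) fun m =>
    sub_nonneg.2 (M.sampleMean_mono m (Nat.zero_le x))

theorem relValue_le (x : ℕ) : M.relValue x ≤ x :=
  le_of_tendsto' (M.tendsto_relValue x) fun m => by linarith [M.sampleMean_le_add m x]

theorem relValue_mono : Monotone M.relValue := fun x y h =>
  le_of_tendsto_of_tendsto' (M.tendsto_relValue x) (M.tendsto_relValue y) fun m => by
    linarith [M.sampleMean_mono m h]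

theorem relValue_succ_le (x : ℕ) : M.relValue (x + 1) ≤ M.relValue x + 1 :=
  le_of_tendsto_of_tendsto' (M.tendsto_relValue (x + 1)) ((M.tendsto_relValue x).add_const 1)
    fun m => by linarith [M.sampleMean_succ_le m x]

/-- The Poisson equation of greedy sampling. -/
theorem integral_relValue (x : ℕ) :
    ∫ v : ℕ, ((if 1 ≤ x + v then 1 else 0 : ℝ) + M.relValue (M.chainStep x v)) ∂M.p.toMeasure =
      M.relValue x + M.chainLimit := by
  have h1 : Tendsto (fun m => (M.sampleMean (m + 1) x - M.sampleMean (m + 1) 0) +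
      M.sampleProb m 0) atTop (𝓝 (M.relValue x + M.chainLimit)) :=
    ((M.tendsto_relValue x).comp (tendsto_add_atTop_nat 1)).add M.tendsto_sampleProb_zero
  refine tendsto_nhds_unique ?_ h1
  have h2 : ∀ m, (M.sampleMean (m + 1) x - M.sampleMean (m + 1) 0) + M.sampleProb m 0 =
      ∫ v : ℕ, ((if 1 ≤ x + v then 1 else 0 : ℝ) +
        (M.sampleMean m (M.chainStep x v) - M.sampleMean m 0)) ∂M.p.toMeasure := by
    intro m
    have h3 : M.sampleMean (m + 1) 0 = M.sampleMean m 0 + M.sampleProb m 0 :=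
      Finset.sum_range_succ _ _
    have hi : Integrable (fun v : ℕ => (if 1 ≤ x + v then 1 else 0 : ℝ) +
        M.sampleMean m (M.chainStep x v)) M.p.toMeasure :=
      (M.integrable_ite x).add (M.integrable_sampleMean m _)
    simp only [← add_sub_assoc]
    rw [integral_sub hi (integrable_const _), ← sampleMean_succ, h3]
    simp only [integral_const, probReal_univ, smul_eq_mul, one_mul]
    ring
  simp only [h2]
  refine tendsto_integral_of_dominated_convergence (fun _ => 1 + (M.C : ℝ))
    (fun m => (measurable_of_countable _).aestronglyMeasurable) (integrable_const _)
    (fun m => Eventually.of_forall fun v => ?_) (Eventually.of_forall fun v => ?_)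
  · have p1 := M.sampleMean_le_add m (M.chainStep x v)
    have p2 := M.sampleMean_mono m (Nat.zero_le (M.chainStep x v))
    have p3 : (M.chainStep x v : ℝ) ≤ M.C := by exact_mod_cast min_le_left _ _
    rw [Real.norm_eq_abs, abs_le]
    split_ifs <;> constructor <;> linarith
  · exact tendsto_const_nhds.add (M.tendsto_relValue _)

theorem lintegral_relValue (x : ℕ) :
    ∫⁻ v : ℕ, ENNReal.ofReal ((if 1 ≤ x + v then 1 else 0 : ℝ) + M.relValue (M.chainStep x v))
      ∂M.p.toMeasure = ENNReal.ofReal (M.relValue x) + ENNReal.ofReal M.chainLimit := by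
  rw [← ENNReal.ofReal_add (M.relValue_nonneg x) M.chainLimit_nonneg, ← integral_relValue,
    ofReal_integral_eq_lintegral_ofReal]
  · refine M.integrable_of_bounded (c := 1 + M.C) fun v => ?_
    have p1 := M.relValue_le (M.chainStep x v)
    have p2 := M.relValue_nonneg (M.chainStep x v)
    have p3 : (M.chainStep x v : ℝ) ≤ M.C := by exact_mod_cast min_le_left _ _
    rw [abs_le]
    split_ifs <;> constructor <;> linarith
  · refine Eventually.of_forall fun v => add_nonneg ?_ (M.relValue_nonneg _)
    split_ifs <;> simp

/-! ### The limit of the greedy sampling probabilities -/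

/-- `greedyRights` as a natural number. -/
def greedyState (k : ℕ) (ω : Path) : ℕ := (M.greedyRights (fun i => nu i ω) k).toNat

theorem greedyRights_nonneg (n : ℕ → ℕ) (k : ℕ) : 0 ≤ M.greedyRights n k := by
  induction k with
  | zero => simp [greedyRights]
  | succ k ih =>
    rw [greedyRights]
    by_cases h : 1 ≤ M.greedyRights n k + n (k + 1)
    · simp only [h, decide_true, Bool.toNat_true]; omega
    · simp only [h, decide_false, Bool.toNat_false]; omega

theorem greedyState_succ (k : ℕ) (ω : Path) :
    M.greedyState (k + 1) ω = M.chainStep (M.greedyState k ω) (nu (k + 1) ω) := by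
  have h0 := M.greedyRights_nonneg (fun i => nu i ω) k
  simp only [greedyState, chainStep, greedyRights]
  by_cases h : 1 ≤ M.greedyRights (fun i => nu i ω) k + nu (k + 1) ω
  · simp only [h, decide_true, Bool.toNat_true]; omega
  · simp only [h, decide_false, Bool.toNat_false]; omega

theorem greedy_succ_iff (k : ℕ) (ω : Path) :
    M.greedy (k + 1) ω = true ↔ 1 ≤ M.greedyState k ω + nu (k + 1) ω := by
  have h0 := M.greedyRights_nonneg (fun i => nu i ω) k
  simp only [greedy, greedyState, decide_eq_true_eq]
  omega

theorem measurable_greedyState (k : ℕ) :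
    Measurable[MeasurableSpace.comap (pastMap k) inferInstance] (M.greedyState k) := by
  induction k with
  | zero => exact measurable_const
  | succ k ih =>
    have h : M.greedyState (k + 1) =
        fun ω => M.chainStep (M.greedyState k ω) (nu (k + 1) ω) :=
      funext fun ω => M.greedyState_succ k ω
    rw [h]
    exact (measurable_of_countable fun z : ℕ × ℕ => M.chainStep z.1 z.2).comp
      ((ih.mono (comap_pastMap_le_succ k) le_rfl).prodMk (measurable_nu_pastMap le_rfl))

theorem lintegral_sampleProb_greedyState (i k : ℕ) :
    ∫⁻ ω, ENNReal.ofReal (M.sampleProb i (M.greedyState k ω)) ∂M.law =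
      ENNReal.ofReal (M.sampleProb (i + k) M.N) := by
  induction k generalizing i with
  | zero => simp [greedyState, greedyRights]
  | succ k ih =>
    have h := M.lintegral_past_nu (M.measurable_greedyState k)
      (φ := fun z => ENNReal.ofReal (M.sampleProb i (M.chainStep z.1 z.2)))
      (measurable_of_countable _)
    simp only [greedyState_succ]
    rw [h, show i + (k + 1) = (i + 1) + k by ring, ← ih]
    refine lintegral_congr fun ω => ?_
    rw [sampleProb, ofReal_integral_eq_lintegral_ofReal (M.integrable_sampleProb i _)
      (Eventually.of_forall fun v => (M.sampleProb_mem i _).1)]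

theorem greedyProb_succ (k : ℕ) : M.greedyProb (k + 1) = M.sampleProb k M.N := by
  have h := M.lintegral_past_nu (M.measurable_greedyState k)
    (φ := fun z => ENNReal.ofReal (if 1 ≤ z.1 + z.2 then 1 else 0 : ℝ))
    (measurable_of_countable _)
  have h1 : ∫⁻ ω, ∫⁻ v : ℕ, ENNReal.ofReal (if 1 ≤ M.greedyState k ω + v then 1 else 0 : ℝ)
      ∂M.p.toMeasure ∂M.law = ENNReal.ofReal (M.sampleProb k M.N) := by
    have := M.lintegral_sampleProb_greedyState 0 k
    rw [zero_add] at this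
    rw [← this]
    refine lintegral_congr fun ω => ?_
    rw [sampleProb, ofReal_integral_eq_lintegral_ofReal (M.integrable_ite _)]
    exact Eventually.of_forall fun v => by dsimp only; split_ifs <;> simp
  dsimp only at h
  rw [h1] at h
  have hm : MeasurableSet {ω | M.greedy (k + 1) ω = true} := by
    simp only [greedy_succ_iff]
    have := (measurable_of_countable fun z : ℕ × ℕ => 1 ≤ z.1 + z.2).comp
      (((M.measurable_greedyState k).mono (measurable_pastMap k).comap_le le_rfl).prodMk
        (measurable_nu (k + 1)))
    exact measurableSet_setOfPred.2 this
  have h2 : M.law {ω | M.greedy (k + 1) ω = true} = ENNReal.ofReal (M.sampleProb k M.N) := by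
    rw [← h, ← lintegral_indicator_one hm]
    refine lintegral_congr fun ω => ?_
    have hiff := M.greedy_succ_iff k ω
    by_cases hg : M.greedy (k + 1) ω = true
    · simp [hg, hiff.1 hg]
    · simp [hg, mt hiff.2 hg]
  rw [greedyProb, measureReal_def, h2, ENNReal.toReal_ofReal (M.sampleProb_mem k _).1]

theorem tendsto_greedyProb_chainLimit : Tendsto M.greedyProb atTop (𝓝 M.chainLimit) := by
  rw [← tendsto_add_atTop_iff_nat 1]
  simp only [greedyProb_succ]
  exact M.tendsto_sampleProb M.N

theorem pTilde_eq : M.pTilde = M.chainLimit := M.tendsto_greedyProb_chainLimit.limUnder_eq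

end ChangeModel

namespace ChangeModel

variable (M : ChangeModel) {μ : ℕ → Path → Bool} {τ : Path → ℕ∞}

/-! ### The number of samples of an admissible strategy -/

/-- The number of sampling rights as a natural number. -/
def rightsState (μ : ℕ → Path → Bool) (k : ℕ) (ω : Path) : ℕ :=
  (M.rights (fun i => nu i ω) (fun i => μ i ω) k).toNat

variable {M} in
theorem Admissible.rights_nonneg (hμ : M.Admissible μ) (ω : Path) (k : ℕ) :
    0 ≤ M.rights (fun i => nu i ω) (fun i => μ i ω) k := by
  rcases Nat.eq_zero_or_pos k with rfl | h
  · simp [rights]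
  · exact hμ.2 ω k h

variable {M} in
theorem Admissible.rightsState_succ (hμ : M.Admissible μ) (k : ℕ) (ω : Path) :
    (μ (k + 1) ω).toNat ≤ M.rightsState μ k ω + nu (k + 1) ω ∧
      M.rightsState μ (k + 1) ω =
        min M.C (M.rightsState μ k ω + nu (k + 1) ω - (μ (k + 1) ω).toNat) := by
  have h0 := hμ.rights_nonneg ω k
  have h1 := hμ.rights_nonneg ω (k + 1)
  simp only [rightsState, rights] at *
  omega

variable {M} in
theorem Admissible.rightsState_le (hμ : M.Admissible μ) (k : ℕ) (ω : Path) :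
    M.rightsState μ k ω ≤ max M.C M.N := by
  cases k with
  | zero => simp [rightsState, rights]
  | succ k => rw [(hμ.rightsState_succ k ω).2]; omega

variable {M} in
theorem Admissible.measurable_rightsState (hμ : M.Admissible μ) (k : ℕ) :
    Measurable[MeasurableSpace.comap (pastMap k) inferInstance] (M.rightsState μ k) := by
  induction k with
  | zero => exact measurable_const
  | succ k ih =>
    have h : M.rightsState μ (k + 1) = fun ω =>
        min M.C (M.rightsState μ k ω + nu (k + 1) ω - (μ (k + 1) ω).toNat) :=
      funext fun ω => (hμ.rightsState_succ k ω).2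
    rw [h]
    exact (measurable_of_countable fun z : (ℕ × ℕ) × Bool =>
      min M.C (z.1.1 + z.1.2 - z.2.toNat)).comp
      (((ih.mono (comap_pastMap_le_succ k) le_rfl).prodMk (measurable_nu_pastMap le_rfl)).prodMk
        (Adapted.measurable_pastMap hμ.1 k))

variable {M} in
/-- Greedy sampling is optimal for the relative value. -/
theorem Admissible.toNat_add_relValue_le (hμ : M.Admissible μ) (k : ℕ) (ω : Path) :
    ((μ (k + 1) ω).toNat : ℝ) + M.relValue (M.rightsState μ (k + 1) ω) ≤
      (if 1 ≤ M.rightsState μ k ω + nu (k + 1) ω then 1 else 0) +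
        M.relValue (M.chainStep (M.rightsState μ k ω) (nu (k + 1) ω)) := by
  obtain ⟨h1, h2⟩ := hμ.rightsState_succ k ω
  rw [h2, chainStep]
  cases hm : μ (k + 1) ω with
  | true =>
    rw [hm] at h1
    rw [if_pos (by simpa using h1)]
    simp
  | false =>
    simp only [Bool.toNat_false, Nat.cast_zero, zero_add, Nat.sub_zero]
    set a := M.rightsState μ k ω + nu (k + 1) ω
    split_ifs with h
    · have hle : min M.C a ≤ min M.C (a - 1) + 1 := by omega
      have := (M.relValue_mono hle).trans (M.relValue_succ_le _)
      linarith
    · have : a = 0 := by omega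
      simp [this]

variable {M} in
theorem Admissible.law_add_lintegral_relValue_le (hμ : M.Admissible μ) {k : ℕ} {F : Set Path}
    (hF : MeasurableSet[MeasurableSpace.comap (pastMap k) inferInstance] F) :
    M.law (F ∩ {ω | μ (k + 1) ω = true}) +
        ∫⁻ ω in F, ENNReal.ofReal (M.relValue (M.rightsState μ (k + 1) ω)) ∂M.law ≤
      ∫⁻ ω in F, ENNReal.ofReal (M.relValue (M.rightsState μ k ω)) ∂M.law +
        ENNReal.ofReal M.chainLimit * M.law F := by
  have hF' := (measurable_pastMap k).comap_le _ hF
  have hμm : MeasurableSet {ω | μ (k + 1) ω = true} :=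
    ((Adapted.measurable_pastMap hμ.1 k).mono (measurable_pastMap (k + 1)).comap_le le_rfl)
      (measurableSet_singleton true)
  have hW : Measurable[MeasurableSpace.comap (pastMap k) inferInstance]
      fun ω => ((ω ∈ F : Prop), M.rightsState μ k ω) :=
    Measurable.prodMk ((@measurableSet_setOfPred Path
      (MeasurableSpace.comap (pastMap k) inferInstance) (fun ω => ω ∈ F)).1 hF) (hμ.measurable_rightsState k)
  classical
  let φ : (Prop × ℕ) × ℕ → ℝ≥0∞ := fun z => if z.1.1 then ENNReal.ofReal
    ((if 1 ≤ z.1.2 + z.2 then 1 else 0 : ℝ) + M.relValue (M.chainStep z.1.2 z.2)) else 0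
  have h := M.lintegral_past_nu hW (φ := φ) (measurable_of_countable φ)
  have hl : M.law (F ∩ {ω | μ (k + 1) ω = true}) +
        ∫⁻ ω in F, ENNReal.ofReal (M.relValue (M.rightsState μ (k + 1) ω)) ∂M.law ≤
      ∫⁻ ω, φ ((ω ∈ F, M.rightsState μ k ω), nu (k + 1) ω) ∂M.law := by
    rw [← lintegral_indicator_one (hF'.inter hμm), ← lintegral_indicator hF',
      ← lintegral_add_left (measurable_one.indicator (hF'.inter hμm))]
    refine lintegral_mono fun ω => ?_
    by_cases hω : ω ∈ F
    · have h1 := ENNReal.ofReal_le_ofReal (hμ.toNat_add_relValue_le k ω)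
      rw [ENNReal.ofReal_add (Nat.cast_nonneg _) (M.relValue_nonneg _)] at h1
      simp only [φ, if_pos hω, Set.indicator_of_mem hω]
      refine le_trans (add_le_add (le_of_eq ?_) le_rfl) h1
      cases hm : μ (k + 1) ω <;> simp [hω, hm]
    · simp [hω]
  refine hl.trans (le_of_eq ?_)
  rw [h, ← setLIntegral_const, ← lintegral_add_right _ measurable_const,
    ← lintegral_indicator hF']
  refine lintegral_congr fun ω => ?_
  by_cases hω : ω ∈ F
  · simp only [φ, if_pos hω, Set.indicator_of_mem hω]
    exact M.lintegral_relValue _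
  · simp [φ, hω]

theorem IsStopping.measurableSet_lt (hτ : IsStopping μ τ) (k : ℕ) :
    MeasurableSet[obsInfo μ k] {ω | (k : ℕ∞) < τ ω} := by
  have : {ω | (k : ℕ∞) < τ ω} = {ω | τ ω ≤ k}ᶜ := by ext ω; simp
  rw [this]
  exact (hτ k).compl

theorem IsStopping.measurableSet_eq (hτ : IsStopping μ τ) (k : ℕ) :
    MeasurableSet[obsInfo μ k] {ω | τ ω = k} := by
  cases k with
  | zero =>
    have : {ω | τ ω = ((0 : ℕ) : ℕ∞)} = {ω | τ ω ≤ ((0 : ℕ) : ℕ∞)} := by ext ω; simp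
    rw [this]; exact hτ 0
  | succ k =>
    have : {ω | τ ω = ((k + 1 : ℕ) : ℕ∞)} = {ω | τ ω ≤ ((k + 1 : ℕ) : ℕ∞)} ∩
        {ω | (k : ℕ∞) < τ ω} := by
      ext ω
      simp only [Set.mem_ofPred_eq, Set.mem_inter_iff]
      cases τ ω with
      | top => simpa using (ENat.natCast_ne_top (k + 1)).symm
      | coe t => norm_cast; omega
    rw [this]
    exact (hτ (k + 1)).inter (obsInfo_mono μ (Nat.le_succ k) _ (hτ.measurableSet_lt k))

theorem lt_coe_iff_succ_le (k : ℕ) (t : ℕ∞) : (k : ℕ∞) < t ↔ ((k + 1 : ℕ) : ℕ∞) ≤ t := by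
  cases t with
  | top => simp
  | coe t => norm_cast

variable {M} in
/-- The mean number of samples between the change and the alarm. -/
theorem Admissible.sum_law_sample_le (hμ : M.Admissible μ) (hτ : IsStopping μ τ) (m : ℕ) :
    ∑ k ∈ Finset.range m, M.law ({ω | (k : ℕ∞) < τ ω} ∩ {ω | μ (k + 1) ω = true} ∩
        {ω | Lam ω ≤ k + 1}) ≤
      ((max M.C M.N : ℕ) : ℝ≥0∞) + ENNReal.ofReal M.chainLimit *
        ∑ k ∈ Finset.range m, M.law ({ω | (k : ℕ∞) < τ ω} ∩ {ω | Lam ω ≤ k + 1}) := by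
  set K : ℝ≥0∞ := ((max M.C M.N : ℕ) : ℝ≥0∞) with hK
  let g : ℕ → Path → ℝ≥0∞ := fun k ω => ENNReal.ofReal (M.relValue (M.rightsState μ k ω))
  have hg : ∀ k ω, g k ω ≤ K := by
    intro k ω
    have h1 : M.relValue (M.rightsState μ k ω) ≤ ((max M.C M.N : ℕ) : ℝ) :=
      (M.relValue_le _).trans (by exact_mod_cast hμ.rightsState_le k ω)
    exact (ENNReal.ofReal_le_ofReal h1).trans (by rw [ENNReal.ofReal_natCast])
  have key : ∀ m, ∑ k ∈ Finset.range m, M.law ({ω | (k : ℕ∞) < τ ω} ∩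
      {ω | μ (k + 1) ω = true} ∩ {ω | Lam ω ≤ k + 1}) +
      ∫⁻ ω in {ω | (m : ℕ∞) ≤ τ ω} ∩ {ω | Lam ω ≤ m}, g m ω ∂M.law ≤
      K * M.law {ω | Lam ω ≤ m} + ENNReal.ofReal M.chainLimit *
        ∑ k ∈ Finset.range m, M.law ({ω | (k : ℕ∞) < τ ω} ∩ {ω | Lam ω ≤ k + 1}) := by
    intro m
    induction m with
    | zero =>
      simp only [Finset.range_zero, Finset.sum_empty, zero_add, mul_zero, add_zero]
      calc _ ≤ ∫⁻ ω in {ω | ((0 : ℕ) : ℕ∞) ≤ τ ω} ∩ {ω | Lam ω ≤ 0}, K ∂M.law :=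
            lintegral_mono fun ω => hg 0 ω
        _ ≤ _ := by
            rw [setLIntegral_const]
            gcongr
            exact Set.inter_subset_right
    | succ m ih =>
      set F : Set Path := {ω | (m : ℕ∞) < τ ω} ∩ {ω | Lam ω ≤ m + 1} with hFdef
      have hF : MeasurableSet[MeasurableSpace.comap (pastMap m) inferInstance] F :=
        (Adapted.obsInfo_le hμ.1 m _ (hτ.measurableSet_lt m)).inter
          ((measurable_Lam_pastMap m)
            (measurableSet_setOfPred.2 (measurable_of_countable fun i => i ≤ m + 1)))
      have hset1 : {ω | ((m + 1 : ℕ) : ℕ∞) ≤ τ ω} ∩ {ω | Lam ω ≤ m + 1} = F := by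
        ext ω; simp only [F, Set.mem_inter_iff, Set.mem_ofPred_eq, lt_coe_iff_succ_le]
      have hset2 : {ω | (m : ℕ∞) < τ ω} ∩ {ω | μ (m + 1) ω = true} ∩ {ω | Lam ω ≤ m + 1} =
          F ∩ {ω | μ (m + 1) ω = true} := by
        ext ω; simp only [F, Set.mem_inter_iff, Set.mem_ofPred_eq]; tauto
      have hstep := hμ.law_add_lintegral_relValue_le hF
      have hsub : F ⊆ ({ω | (m : ℕ∞) ≤ τ ω} ∩ {ω | Lam ω ≤ m}) ∪ {ω | Lam ω = m + 1} := by
        rintro ω ⟨h1, h2⟩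
        rcases Nat.le_succ_iff.1 h2 with h3 | h3
        · exact Or.inl ⟨show (m : ℕ∞) ≤ τ ω from le_of_lt h1, h3⟩
        · exact Or.inr h3
      have hmono : ∫⁻ ω in F, g m ω ∂M.law ≤
          ∫⁻ ω in {ω | (m : ℕ∞) ≤ τ ω} ∩ {ω | Lam ω ≤ m}, g m ω ∂M.law +
            K * M.law {ω | Lam ω = m + 1} := by
        refine (lintegral_mono_set hsub).trans ((lintegral_union_le _ _ _).trans ?_)
        gcongr
        rw [← setLIntegral_const]
        exact lintegral_mono fun ω => hg m ω
      have hLam : M.law {ω | Lam ω ≤ m + 1} =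
          M.law {ω | Lam ω ≤ m} + M.law {ω | Lam ω = m + 1} := by
        rw [← measure_union _ (measurableSet_Lam fun i => i = m + 1)]
        · congr 1
          ext ω
          simp only [Set.mem_ofPred_eq, Set.mem_union]
          omega
        · rw [Set.disjoint_left]
          intro ω h1 h2
          simp only [Set.mem_ofPred_eq] at h1 h2
          omega
      rw [Finset.sum_range_succ, Finset.sum_range_succ, hset1, hset2, hLam]
      calc _ = ∑ k ∈ Finset.range m, M.law ({ω | (k : ℕ∞) < τ ω} ∩
              {ω | μ (k + 1) ω = true} ∩ {ω | Lam ω ≤ k + 1}) +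
            (M.law (F ∩ {ω | μ (m + 1) ω = true}) + ∫⁻ ω in F, g (m + 1) ω ∂M.law) := by
              rw [add_assoc]
        _ ≤ ∑ k ∈ Finset.range m, M.law ({ω | (k : ℕ∞) < τ ω} ∩
              {ω | μ (k + 1) ω = true} ∩ {ω | Lam ω ≤ k + 1}) +
            ((∫⁻ ω in {ω | (m : ℕ∞) ≤ τ ω} ∩ {ω | Lam ω ≤ m}, g m ω ∂M.law +
              K * M.law {ω | Lam ω = m + 1}) + ENNReal.ofReal M.chainLimit * M.law F) := by
              exact add_le_add le_rfl (hstep.trans (add_le_add hmono le_rfl))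
        _ = (∑ k ∈ Finset.range m, M.law ({ω | (k : ℕ∞) < τ ω} ∩
              {ω | μ (k + 1) ω = true} ∩ {ω | Lam ω ≤ k + 1}) +
            ∫⁻ ω in {ω | (m : ℕ∞) ≤ τ ω} ∩ {ω | Lam ω ≤ m}, g m ω ∂M.law) +
            (K * M.law {ω | Lam ω = m + 1} + ENNReal.ofReal M.chainLimit * M.law F) := by ring
        _ ≤ _ + (K * M.law {ω | Lam ω = m + 1} + ENNReal.ofReal M.chainLimit * M.law F) :=
              add_le_add ih le_rfl
        _ = _ := by ring
  calc _ ≤ _ := le_self_add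
    _ ≤ _ := key m
    _ ≤ _ := by
      gcongr
      exact mul_le_of_le_one_right' prob_le_one

end ChangeModel

namespace ChangeModel

variable (M : ChangeModel) {μ : ℕ → Path → Bool} {τ : Path → ℕ∞}

/-- `E[Λ]`. -/
def meanLam : ℝ≥0∞ := ∫⁻ ω, (Lam ω : ℝ≥0∞) ∂M.law

theorem meanLam_ne_top : M.meanLam ≠ ⊤ := by
  have h1 : ∀ j, ∫⁻ ω, (Lam ω : ℝ≥0∞) ∂M.condLaw j = j := by
    intro j
    rw [lintegral_congr_ae (g := fun _ => (j : ℝ≥0∞))]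
    · simp
    · filter_upwards [M.Lam_condLaw j] with ω hω
      rw [hω]
  have h2 : ∀ j : ℕ, ENNReal.ofReal (M.prior j) * (j : ℝ≥0∞) = ENNReal.ofReal (M.prior j * j) := by
    intro j
    rw [ENNReal.ofReal_mul (M.prior_nonneg j), ENNReal.ofReal_natCast]
  rw [meanLam, lintegral_law]
  simp only [h1, h2]
  have hs : Summable fun j : ℕ => M.prior j * j := by
    rw [← summable_nat_add_iff 1]
    have hr : ‖1 - M.ρ‖ < 1 := by
      rw [Real.norm_eq_abs, abs_lt]; constructor <;> linarith [M.ρ_pos, M.ρ_lt_one]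
    have g1 := summable_pow_mul_geometric_of_norm_lt_one 1 hr
    have g0 := summable_geometric_of_norm_lt_one hr
    refine ((g1.add g0).mul_left (M.ρ * (1 - M.π₀))).congr fun j => ?_
    rw [prior_succ, priorTail]
    push_cast
    ring
  rw [← ENNReal.ofReal_tsum_of_nonneg
    (fun j => mul_nonneg (M.prior_nonneg j) (Nat.cast_nonneg j)) hs]
  exact ENNReal.ofReal_ne_top

theorem sum_measure_eq_lintegral {Ω : Type*} [MeasurableSpace Ω] (P : Measure Ω) (m : ℕ)
    (A : ℕ → Set Ω) (hA : ∀ k, MeasurableSet (A k)) :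
    ∑ k ∈ Finset.range m, P (A k) =
      ∫⁻ ω, ∑ k ∈ Finset.range m, (A k).indicator 1 ω ∂P := by
  rw [lintegral_finsetSum _ fun k _ => measurable_one.indicator (hA k)]
  exact Finset.sum_congr rfl fun k _ => (lintegral_indicator_one (hA k)).symm

theorem sum_indicator_eq_card {Ω : Type*} (m : ℕ) (A : ℕ → Set Ω) (ω : Ω)
    [DecidablePred fun k => ω ∈ A k] :
    ∑ k ∈ Finset.range m, (A k).indicator (1 : Ω → ℝ≥0∞) ω =
      (((Finset.range m).filter fun k => ω ∈ A k).card : ℝ≥0∞) := by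
  simp [Set.indicator_apply]

theorem sum_law_lt_le (m : ℕ) (h : ∀ k : ℕ, MeasurableSet {ω | (k : ℕ∞) < τ ω}) :
    ∑ k ∈ Finset.range m, M.law {ω | (k : ℕ∞) < τ ω} ≤ M.ADD τ + M.meanLam := by
  classical
  have hm : Measurable fun ω : Path => (Lam ω : ℝ≥0∞) :=
    (measurable_of_countable fun n : ℕ => (n : ℝ≥0∞)).comp measurable_Lam
  rw [sum_measure_eq_lintegral _ _ _ h, ADD, meanLam, ← lintegral_add_right _ hm]
  refine lintegral_mono fun ω => ?_
  rw [sum_indicator_eq_card]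
  simp only [Set.mem_ofPred_eq]
  cases hτ : τ ω with
  | top => simp
  | coe t =>
    have hc : ((Finset.range m).filter fun k : ℕ => (k : ℕ∞) < t).card ≤ (t - Lam ω) + Lam ω := by
      calc _ ≤ (Finset.range t).card := by
            refine Finset.card_le_card fun k hk => ?_
            simpa using (Finset.mem_filter.1 hk).2
        _ = t := Finset.card_range t
        _ ≤ _ := by omega
    have : ((t : ℕ∞) - (Lam ω : ℕ∞) : ℕ∞) = ((t - Lam ω : ℕ) : ℕ∞) := by norm_cast
    rw [this]
    exact_mod_cast hc

theorem sum_law_between_le (m : ℕ) (h : ∀ k : ℕ, MeasurableSet {ω | (k : ℕ∞) < τ ω}) :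
    ∑ k ∈ Finset.range m, M.law ({ω | (k : ℕ∞) < τ ω} ∩ {ω | Lam ω ≤ k + 1}) ≤
      M.ADD τ + 1 := by
  classical
  rw [sum_measure_eq_lintegral _ _ _ fun k =>
    (h k).inter (measurableSet_Lam fun i => i ≤ k + 1), ADD]
  have h1 : (1 : ℝ≥0∞) = ∫⁻ _, 1 ∂M.law := by simp
  rw [h1, ← lintegral_add_right _ measurable_const]
  refine lintegral_mono fun ω => ?_
  rw [sum_indicator_eq_card]
  simp only [Set.mem_ofPred_eq, Set.mem_inter_iff]
  cases hτ : τ ω with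
  | top => simp
  | coe t =>
    have hc : ((Finset.range m).filter fun k : ℕ => (k : ℕ∞) < t ∧ Lam ω ≤ k + 1).card ≤
        (t - Lam ω) + 1 := by
      calc _ ≤ (Finset.Icc (Lam ω) t).card := by
            refine Finset.card_le_card_of_injOn (fun k => k + 1) (fun k hk => ?_)
              (fun a _ b _ hab => by simpa using hab)
            have h2 := (Finset.mem_filter.1 hk).2
            have h3 : k < t := by exact_mod_cast h2.1
            simp only [Finset.coe_Icc, Set.mem_Icc]
            omega
        _ = t + 1 - Lam ω := Nat.card_Icc _ _
        _ ≤ _ := by omega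
    have : ((t : ℕ∞) - (Lam ω : ℕ∞) : ℕ∞) = ((t - Lam ω : ℕ) : ℕ∞) := by norm_cast
    rw [this]
    exact_mod_cast hc

theorem notChanged_zero (μ : ℕ → Path → Bool) (ω : Path) : M.notChanged μ 0 ω = 1 - M.π₀ := by
  simp [notChanged, density, priorTail, changedDensity]

variable {M} in
/-- The mean of `-log P(Λ > τ ∧ n | Z_1, …, Z_{τ ∧ n})`. -/
theorem Admissible.sum_lintegral_neg_log_notChanged_le (hD : M.klD ≠ ⊤) (hμ : M.Admissible μ)
    (hτ : IsStopping μ τ) (n : ℕ) :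
    ∑ k ∈ Finset.range (n + 1),
        ∫⁻ ω in {ω | τ ω = k}, ENNReal.ofReal (-Real.log (M.notChanged μ k ω)) ∂M.law +
      ∫⁻ ω in {ω | (n : ℕ∞) < τ ω}, ENNReal.ofReal (-Real.log (M.notChanged μ n ω)) ∂M.law ≤
    ENNReal.ofReal (-Real.log (1 - M.π₀)) +
      ENNReal.ofReal |Real.log (1 - M.ρ)| * ∑ k ∈ Finset.range n, M.law {ω | (k : ℕ∞) < τ ω} +
      M.klD * ∑ k ∈ Finset.range n, M.law ({ω | (k : ℕ∞) < τ ω} ∩ {ω | μ (k + 1) ω = true} ∩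
        {ω | Lam ω ≤ k + 1}) := by
  have had : Adapted μ := hμ.1
  have hlt : ∀ k : ℕ, MeasurableSet {ω | (k : ℕ∞) < τ ω} := fun k =>
    had.obsInfo_le_univ k _ (hτ.measurableSet_lt k)
  induction n with
  | zero =>
    simp only [zero_add, Finset.range_one, Finset.sum_singleton, Finset.range_zero,
      Finset.sum_empty, mul_zero, add_zero, notChanged_zero, setLIntegral_const]
    rw [← mul_add]
    refine mul_le_of_le_one_right' ?_
    rw [← measure_union _ (hlt 0)]
    · exact prob_le_one
    · rw [Set.disjoint_left]
      intro ω h1 h2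
      simp only [Set.mem_ofPred_eq] at h1 h2
      exact absurd h1 h2.ne'
  | succ n ih =>
    have hset : {ω | (n : ℕ∞) < τ ω} =
        {ω | τ ω = ((n + 1 : ℕ) : ℕ∞)} ∪ {ω | ((n + 1 : ℕ) : ℕ∞) < τ ω} := by
      ext ω
      simp only [Set.mem_ofPred_eq, Set.mem_union, lt_coe_iff_succ_le n]
      rw [le_iff_eq_or_lt, eq_comm]
    have hdis : Disjoint {ω | τ ω = ((n + 1 : ℕ) : ℕ∞)} {ω | ((n + 1 : ℕ) : ℕ∞) < τ ω} := by
      rw [Set.disjoint_left]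
      intro ω h1 h2
      simp only [Set.mem_ofPred_eq] at h1 h2
      exact absurd h1 h2.ne'
    rw [Finset.sum_range_succ _ (n + 1), add_assoc, ← lintegral_union (hlt (n + 1)) hdis, ← hset]
    have hF : MeasurableSet[fullInfo μ n] {ω | (n : ℕ∞) < τ ω} :=
      (le_sup_left : obsInfo μ n ≤ fullInfo μ n) _ (hτ.measurableSet_lt n)
    have hstep := had.lintegral_neg_log_notChanged_succ_le M hD hF
    refine (add_le_add le_rfl hstep).trans ?_
    rw [← add_assoc, ← add_assoc, Finset.sum_range_succ (fun k : ℕ => M.law {ω | (k : ℕ∞) < τ ω}),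
      Finset.sum_range_succ (fun k : ℕ => M.law ({ω | (k : ℕ∞) < τ ω} ∩
        {ω | μ (k + 1) ω = true} ∩ {ω | Lam ω ≤ k + 1}))]
    refine (add_le_add (add_le_add ih le_rfl) le_rfl).trans (le_of_eq ?_)
    ring

theorem le_neg_log_add {α w : ℝ} (hα : 0 < α) (hα1 : α < 1) (hw : 0 < w) :
    |Real.log α| + 1 ≤ -Real.log w + α⁻¹ * w := by
  have h := Real.log_le_sub_one_of_pos (mul_pos (inv_pos.2 hα) hw)
  rw [Real.log_mul (inv_pos.2 hα).ne' hw.ne', Real.log_inv] at h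
  rw [abs_of_neg (Real.log_neg hα hα1)]
  linarith

/-- The constant in the lower bound on the delay. -/
def delayConst : ℝ≥0∞ :=
  ENNReal.ofReal (-Real.log (1 - M.π₀)) + ENNReal.ofReal |Real.log (1 - M.ρ)| * M.meanLam +
    M.klD * (((max M.C M.N : ℕ) : ℝ≥0∞) + ENNReal.ofReal M.chainLimit)

theorem delayConst_ne_top (hD : M.klD ≠ ⊤) : M.delayConst ≠ ⊤ := by
  refine ENNReal.add_ne_top.2 ⟨ENNReal.add_ne_top.2 ⟨ENNReal.ofReal_ne_top,
    ENNReal.mul_ne_top ENNReal.ofReal_ne_top M.meanLam_ne_top⟩, ENNReal.mul_ne_top hD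
      (ENNReal.add_ne_top.2 ⟨ENNReal.natCast_ne_top _, ENNReal.ofReal_ne_top⟩)⟩

variable {M} in
/-- Nonasymptotic lower bound on the delay of an admissible pair. -/
theorem Admissible.ofReal_abs_log_le (hD : M.klD ≠ ⊤) (hμ : M.Admissible μ)
    (hτ : IsStopping μ τ) {α : ℝ} (hα : 0 < α) (hα1 : α < 1)
    (hPFA : M.PFA τ ≤ ENNReal.ofReal α) (hADD : M.ADD τ ≠ ⊤) :
    ENNReal.ofReal |Real.log α| ≤ M.delayConst +
      M.ADD τ * (ENNReal.ofReal |Real.log (1 - M.ρ)| +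
        M.klD * ENNReal.ofReal M.chainLimit) := by
  have had : Adapted μ := hμ.1
  have hlt : ∀ k : ℕ, MeasurableSet {ω | (k : ℕ∞) < τ ω} := fun k =>
    had.obsInfo_le_univ k _ (hτ.measurableSet_lt k)
  have heq : ∀ k : ℕ, MeasurableSet {ω | τ ω = k} := fun k =>
    had.obsInfo_le_univ k _ (hτ.measurableSet_eq k)
  have hdis : Pairwise (Function.onFun Disjoint fun k : ℕ => {ω | τ ω = k}) := by
    intro i j hij
    rw [Function.onFun, Set.disjoint_left]
    intro ω h1 h2
    simp only [Set.mem_ofPred_eq] at h1 h2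
    rw [h1] at h2
    exact hij (by exact_mod_cast h2)
  set q : ℝ≥0∞ := ENNReal.ofReal |Real.log (1 - M.ρ)| + M.klD * ENNReal.ofReal M.chainLimit
  have hfinite : ∑' k : ℕ, M.law {ω | τ ω = k} = 1 := by
    rw [← measure_iUnion hdis heq]
    have hc : (⋃ k : ℕ, {ω | τ ω = k}) = {ω | τ ω = ⊤}ᶜ := by
      ext ω
      simp only [Set.mem_iUnion, Set.mem_ofPred_eq, Set.mem_compl_iff]
      constructor
      · rintro ⟨k, hk⟩; rw [hk]; exact ENat.natCast_ne_top k
      · intro h; exact ⟨(τ ω).toNat, (ENat.natCast_toNat h).symm⟩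
    have hm : MeasurableSet {ω | τ ω = ⊤} := by
      have := MeasurableSet.iUnion heq
      rw [hc] at this
      exact this.of_compl
    have hz : M.law {ω | τ ω = ⊤} = 0 := by
      by_contra hne
      have hbd : ∀ n : ℕ, (n : ℝ≥0∞) * M.law {ω | τ ω = ⊤} ≤ M.ADD τ + M.meanLam := by
        intro n
        refine le_trans ?_ (M.sum_law_lt_le n hlt)
        calc (n : ℝ≥0∞) * M.law {ω | τ ω = ⊤} =
              ∑ k ∈ Finset.range n, M.law {ω | τ ω = ⊤} := by simp
          _ ≤ _ := by
            refine Finset.sum_le_sum fun k _ => measure_mono fun ω hω => ?_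
            have h : τ ω = ⊤ := hω
            simp [h]
      obtain ⟨n, hn⟩ := ENNReal.exists_nat_mul_gt hne
        (ENNReal.add_ne_top.2 ⟨hADD, M.meanLam_ne_top⟩)
      exact absurd (hbd n) (not_le.2 hn)
    rw [hc, measure_compl hm (measure_ne_top _ _), hz, measure_univ, tsub_zero]
  have hfa : ∀ n, ∑ k ∈ Finset.range n, M.law ({ω | τ ω = k} ∩ {ω | k < Lam ω}) ≤
      ENNReal.ofReal α := by
    intro n
    rw [← measure_biUnion_finset]
    · refine le_trans (measure_mono ?_) hPFA
      intro ω hω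
      simp only [Set.mem_iUnion, Set.mem_inter_iff, Set.mem_ofPred_eq] at hω
      obtain ⟨k, _, h1, h2⟩ := hω
      simp only [Set.mem_ofPred_eq]
      rw [h1]; exact_mod_cast h2
    · intro i _ j _ hij
      exact (hdis hij).mono Set.inter_subset_left Set.inter_subset_left
    · exact fun k _ => (heq k).inter (measurableSet_Lam fun i => k < i)
  have hslot : ∀ k : ℕ, ENNReal.ofReal (|Real.log α| + 1) * M.law {ω | τ ω = k} ≤
      ∫⁻ ω in {ω | τ ω = k}, ENNReal.ofReal (-Real.log (M.notChanged μ k ω)) ∂M.law +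
        ENNReal.ofReal α⁻¹ * M.law ({ω | τ ω = k} ∩ {ω | k < Lam ω}) := by
    intro k
    have hn : Measurable fun ω => ENNReal.ofReal (M.notChanged μ k ω) :=
      ((M.measurable_notChanged μ k).mono (had.obsInfo_le_univ k) le_rfl).ennreal_ofReal
    rw [had.law_inter_Lam_gt_eq M hD
      ((le_sup_left : obsInfo μ k ≤ fullInfo μ k) _ (hτ.measurableSet_eq k)),
      ← lintegral_const_mul _ hn, ← lintegral_add_right _ (hn.const_mul _), ← setLIntegral_const]
    refine lintegral_mono fun ω => ?_
    rw [← ENNReal.ofReal_mul (inv_pos.2 hα).le, ← ENNReal.ofReal_add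
      (M.neg_log_notChanged_nonneg μ k ω)
      (mul_pos (inv_pos.2 hα) (M.notChanged_pos μ k ω)).le]
    exact ENNReal.ofReal_le_ofReal (le_neg_log_add hα hα1 (M.notChanged_pos μ k ω))
  have hbound : ∀ n : ℕ, ∑ k ∈ Finset.range n,
      ENNReal.ofReal (|Real.log α| + 1) * M.law {ω | τ ω = k} ≤ (M.delayConst + M.ADD τ * q) + 1 := by
    intro n
    refine (Finset.sum_le_sum fun k _ => hslot k).trans ?_
    rw [Finset.sum_add_distrib, ← Finset.mul_sum]
    refine add_le_add ?_ ?_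
    · refine le_trans ?_ ((hμ.sum_lintegral_neg_log_notChanged_le hD hτ n).trans ?_)
      · rw [Finset.sum_range_succ, add_assoc]
        exact le_self_add
      · have b1 := M.sum_law_lt_le n hlt
        have b2 := (hμ.sum_law_sample_le hτ n).trans
          (add_le_add le_rfl (mul_le_mul' le_rfl (M.sum_law_between_le n hlt)))
        refine (add_le_add (add_le_add le_rfl (mul_le_mul' le_rfl b1))
          (mul_le_mul' le_rfl b2)).trans (le_of_eq ?_)
        simp only [delayConst, q]
        ring
    · refine (mul_le_mul' le_rfl (hfa n)).trans (le_of_eq ?_)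
      rw [← ENNReal.ofReal_mul (inv_pos.2 hα).le, inv_mul_cancel₀ hα.ne', ENNReal.ofReal_one]
  have htot := ENNReal.tsum_le_of_sum_range_le hbound
  rw [ENNReal.tsum_mul_left, hfinite, mul_one, ENNReal.ofReal_add (abs_nonneg _) zero_le_one,
    ENNReal.ofReal_one] at htot
  exact (ENNReal.add_le_add_iff_right ENNReal.one_ne_top).1 htot

end ChangeModel

namespace ChangeModel

variable (M : ChangeModel) {μ : ℕ → Path → Bool} {τ : Path → ℕ∞}

/-! ### Feasibility of the greedy threshold rule -/

theorem measurable_greedyState_nu (k : ℕ) :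
    Measurable[⨆ i ∈ Finset.Icc 1 k, MeasurableSpace.comap (nu i) inferInstance]
      (M.greedyState k) := by
  induction k with
  | zero => exact measurable_const
  | succ k ih =>
    have h : M.greedyState (k + 1) =
        fun ω => M.chainStep (M.greedyState k ω) (nu (k + 1) ω) :=
      funext fun ω => M.greedyState_succ k ω
    rw [h]
    have h1 : (⨆ i ∈ Finset.Icc 1 k, MeasurableSpace.comap (nu i) inferInstance) ≤
        ⨆ i ∈ Finset.Icc 1 (k + 1), MeasurableSpace.comap (nu i) inferInstance :=
      biSup_mono fun i hi => Finset.Icc_subset_Icc_right (Nat.le_succ k) hi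
    have h2 : Measurable[⨆ i ∈ Finset.Icc 1 (k + 1), MeasurableSpace.comap (nu i) inferInstance]
        (nu (k + 1)) :=
      (comap_measurable _).mono (le_iSup₂_of_le (k + 1) (Finset.mem_Icc.2 ⟨by omega, le_rfl⟩)
        le_rfl) le_rfl
    exact (measurable_of_countable fun z : ℕ × ℕ => M.chainStep z.1 z.2).comp
      ((ih.mono h1 le_rfl).prodMk h2)

theorem admissible_greedy : M.Admissible M.greedy := by
  refine ⟨fun k hk => ?_, fun ω k _ => ?_⟩
  · obtain ⟨k, rfl⟩ : ∃ i, k = i + 1 := ⟨k - 1, by omega⟩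
    have h : M.greedy (k + 1) = fun ω => decide (1 ≤ M.greedyState k ω + nu (k + 1) ω) := by
      funext ω
      rw [Bool.eq_iff_iff, greedy_succ_iff, decide_eq_true_eq]
    have h1 : (⨆ i ∈ Finset.Icc 1 k, MeasurableSpace.comap (nu i) inferInstance) ≤
        decisionInfo M.greedy (k + 1) :=
      (biSup_mono fun i hi => Finset.Icc_subset_Icc_right (Nat.le_succ k) hi).trans
        (le_sup_right.trans le_sup_left)
    have h2 : Measurable[decisionInfo M.greedy (k + 1)] (nu (k + 1)) :=
      (comap_measurable _).mono ((le_iSup₂_of_le (f := fun i (_ : i ∈ Finset.Icc 1 (k + 1)) =>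
        MeasurableSpace.comap (nu i) inferInstance) (k + 1) (Finset.mem_Icc.2 ⟨by omega, le_rfl⟩)
        le_rfl).trans (le_sup_right.trans le_sup_left)) le_rfl
    have h3 := (measurable_of_countable fun z : ℕ × ℕ => decide (1 ≤ z.1 + z.2)).comp
      (((M.measurable_greedyState_nu k).mono h1 le_rfl).prodMk h2)
    rw [h]
    exact h3
  · rw [rights_greedy]
    exact M.greedyRights_nonneg _ k

theorem adapted_greedy : Adapted M.greedy := M.admissible_greedy.1

theorem threshold_le_iff (α : ℝ) (k : ℕ) (ω : Path) :
    M.threshold α ω ≤ k ↔ ∃ i ≤ k, 1 - α ≤ M.posterior M.greedy i ω := by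
  constructor
  · intro h
    by_contra! hc
    have h1 : ((k + 1 : ℕ) : ℕ∞) ≤ M.threshold α ω := by
      refine le_iInf₂ fun i hi => ?_
      have : ¬ i ≤ k := fun hik => absurd hi (not_le.2 (hc i hik))
      exact_mod_cast (by omega : k + 1 ≤ i)
    have := h1.trans h
    norm_cast at this
    omega
  · rintro ⟨i, hik, hi⟩
    exact (iInf₂_le i hi).trans (by exact_mod_cast hik)

theorem isStopping_threshold (α : ℝ) : IsStopping M.greedy (M.threshold α) := by
  intro k
  have h : {ω | M.threshold α ω ≤ k} =
      ⋃ i ∈ Finset.Iic k, {ω | 1 - α ≤ M.posterior M.greedy i ω} := by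
    ext ω
    simp [threshold_le_iff]
  rw [h]
  refine Finset.measurableSet_biUnion _ fun i hi => ?_
  refine obsInfo_mono M.greedy (Finset.mem_Iic.1 hi) _ ?_
  exact measurableSet_le measurable_const stronglyMeasurable_condExp.measurable

theorem posterior_of_threshold_eq {α : ℝ} {k : ℕ} {ω : Path} (h : M.threshold α ω = k) :
    1 - α ≤ M.posterior M.greedy k ω := by
  obtain ⟨i, hik, hi⟩ := (M.threshold_le_iff α k ω).1 h.le
  have h1 : M.threshold α ω ≤ i := (M.threshold_le_iff α i ω).2 ⟨i, le_rfl, hi⟩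
  rw [h] at h1
  have h2 : k ≤ i := by exact_mod_cast h1
  rwa [le_antisymm h2 hik]

theorem PFA_threshold_le (hD : M.klD ≠ ⊤) (α : ℝ) :
    M.PFA (M.threshold α) ≤ ENNReal.ofReal α := by
  have had := M.adapted_greedy
  have hτ := M.isStopping_threshold α
  have heq : ∀ k : ℕ, MeasurableSet {ω | M.threshold α ω = k} := fun k =>
    had.obsInfo_le_univ k _ (hτ.measurableSet_eq k)
  have hdis : Pairwise (Function.onFun Disjoint fun k : ℕ => {ω | M.threshold α ω = k}) := by
    intro i j hij
    rw [Function.onFun, Set.disjoint_left]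
    intro ω h1 h2
    simp only [Set.mem_ofPred_eq] at h1 h2
    rw [h1] at h2
    exact hij (by exact_mod_cast h2)
  have hsub : {ω | M.threshold α ω < (Lam ω : ℕ∞)} ⊆
      ⋃ k : ℕ, ({ω | M.threshold α ω = k} ∩ {ω | k < Lam ω}) := by
    intro ω hω
    have h1 : M.threshold α ω < (Lam ω : ℕ∞) := hω
    obtain ⟨k, hk⟩ := ENat.ne_top_iff_exists.1 h1.ne_top
    rw [← hk] at h1
    exact Set.mem_iUnion.2 ⟨k, hk.symm, by exact_mod_cast h1⟩
  calc M.PFA (M.threshold α)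
      ≤ ∑' k : ℕ, M.law ({ω | M.threshold α ω = k} ∩ {ω | k < Lam ω}) :=
        (measure_mono hsub).trans (measure_iUnion_le _)
    _ ≤ ∑' k : ℕ, ENNReal.ofReal α * M.law {ω | M.threshold α ω = k} := by
        refine ENNReal.tsum_le_tsum fun k => ?_
        rw [had.law_inter_Lam_gt_eq M hD ((le_sup_left : obsInfo M.greedy k ≤ fullInfo M.greedy k)
          _ (hτ.measurableSet_eq k)), ← setLIntegral_const]
        refine setLIntegral_mono_ae measurable_const.aemeasurable ?_
        filter_upwards [had.posterior_ae_eq M hD k] with ω hω h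
        have := M.posterior_of_threshold_eq h
        rw [hω] at this
        exact ENNReal.ofReal_le_ofReal (by linarith)
    _ = ENNReal.ofReal α * M.law (⋃ k : ℕ, {ω | M.threshold α ω = k}) := by
        rw [ENNReal.tsum_mul_left, measure_iUnion hdis heq]
    _ ≤ ENNReal.ofReal α := mul_le_of_le_one_right' prob_le_one

/-! ### Delay of the greedy threshold rule -/

theorem prior_mul_prod_le_changedDensity (μ : ℕ → Path → Bool) (j n : ℕ) (ω : Path) :
    M.prior (j + 1) * ∏ i ∈ Finset.Ico (j + 1) (j + 1 + (n + 1)), M.obsLR (obs μ i ω) ≤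
      M.changedDensity μ (j + n + 1) ω := by
  induction n with
  | zero =>
    rw [Nat.Ico_succ_singleton, Finset.prod_singleton]
    exact mul_le_mul_of_nonneg_right
      (le_add_of_nonneg_left (M.changedDensity_nonneg μ j ω)) (M.obsLR_nonneg _)
  | succ n ih =>
    rw [show j + 1 + (n + 1 + 1) = (j + 1 + (n + 1)) + 1 by ring,
      Finset.prod_Ico_succ_top (by omega), ← mul_assoc]
    rw [show j + (n + 1) + 1 = (j + n + 1) + 1 by ring, changedDensity,
      show j + 1 + (n + 1) = j + n + 1 + 1 by ring] at *
    exact mul_le_mul_of_nonneg_right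
      (ih.trans (le_add_of_nonneg_right (M.prior_nonneg _))) (M.obsLR_nonneg _)

theorem loglik_eq_log_obsLR (μ : ℕ → Path → Bool) (i : ℕ) (ω : Path) :
    M.loglik μ i ω = Real.log (M.obsLR (obs μ i ω)) := by
  unfold loglik obs
  split_ifs
  · rfl
  · simp [obsLR]

theorem le_neg_log_notChanged {j n : ℕ} {ω : Path}
    (h : ∀ i, j + 1 ≤ i → 0 < M.obsLR (obs μ i ω)) :
    Real.log M.ρ + (n + 1 : ℕ) * |Real.log (1 - M.ρ)| +
      ∑ i ∈ Finset.Ico (j + 1) (j + 1 + (n + 1)), M.loglik μ i ω ≤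
      -Real.log (M.notChanged μ (j + n + 1) ω) := by
  have hρ : 0 < 1 - M.ρ := by linarith [M.ρ_lt_one]
  have hpos : ∀ i ∈ Finset.Ico (j + 1) (j + 1 + (n + 1)), 0 < M.obsLR (obs μ i ω) :=
    fun i hi => h i (Finset.mem_Ico.1 hi).1
  set P := ∏ i ∈ Finset.Ico (j + 1) (j + 1 + (n + 1)), M.obsLR (obs μ i ω) with hP
  have hP0 : 0 < P := Finset.prod_pos hpos
  have hsum : ∑ i ∈ Finset.Ico (j + 1) (j + 1 + (n + 1)), M.loglik μ i ω = Real.log P := by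
    rw [hP, Real.log_prod fun i hi => (hpos i hi).ne']
    exact Finset.sum_congr rfl fun i _ => M.loglik_eq_log_obsLR μ i ω
  have hB := M.priorTail_pos j
  have hBk : M.priorTail (j + n + 1) = M.priorTail j * (1 - M.ρ) ^ (n + 1) := by
    simp only [priorTail]; rw [show j + n + 1 = j + (n + 1) by ring, pow_add]; ring
  have hlog : Real.log (1 - M.ρ) ≤ 0 := Real.log_nonpos hρ.le (by linarith [M.ρ_pos])
  have hle : M.notChanged μ (j + n + 1) ω ≤ (1 - M.ρ) ^ (n + 1) / (M.ρ * P) := by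
    have h1 := M.prior_mul_prod_le_changedDensity μ j n ω
    rw [prior_succ, ← hP] at h1
    have h2 : M.ρ * M.priorTail j * P ≤ M.density μ (j + n + 1) ω :=
      h1.trans (le_add_of_nonneg_right (M.priorTail_pos _).le)
    have h3 : 0 < M.ρ * M.priorTail j * P := mul_pos (mul_pos M.ρ_pos hB) hP0
    calc M.notChanged μ (j + n + 1) ω ≤ M.priorTail (j + n + 1) / (M.ρ * M.priorTail j * P) :=
          div_le_div_of_nonneg_left (M.priorTail_pos _).le h3 h2
      _ = _ := by
          rw [hBk]
          have := M.ρ_pos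
          field_simp
  have h4 := Real.log_le_log (M.notChanged_pos μ _ ω) hle
  rw [Real.log_div (pow_pos hρ _).ne' (mul_pos M.ρ_pos hP0).ne', Real.log_pow,
    Real.log_mul M.ρ_pos.ne' hP0.ne'] at h4
  rw [hsum, abs_of_nonpos hlog]
  linarith

/-- The information rate `p̃ D(f1 ‖ f0) + |log (1 - ρ)|`. -/
def rate : ℝ := M.pTilde * M.klD.toReal + |Real.log (1 - M.ρ)|

theorem rate_pos : 0 < M.rate := by
  have h1 : Real.log (1 - M.ρ) < 0 :=
    Real.log_neg (by linarith [M.ρ_lt_one]) (by linarith [M.ρ_pos])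
  have h2 : 0 ≤ M.pTilde := by rw [pTilde_eq]; exact M.chainLimit_nonneg
  exact add_pos_of_nonneg_of_pos (mul_nonneg h2 ENNReal.toReal_nonneg) (abs_pos.2 h1.ne)

theorem threshold_sub_le {α ε : ℝ} (hα : 0 < α) (hα1 : α < 1) (hε : ε < M.rate)
    {ω : Path} (hpost : ∀ k, M.posterior M.greedy k ω = 1 - M.notChanged M.greedy k ω)
    (hpos : ∀ i, max (Lam ω) 1 ≤ i → 0 < M.obsLR (obs M.greedy i ω)) :
    ((M.threshold α ω - (Lam ω : ℕ∞) : ℕ∞) : ℝ≥0∞) ≤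
      (M.lastExit ε (max (Lam ω) 1) ω : ℝ≥0∞) +
        ENNReal.ofReal ((|Real.log α| + |Real.log M.ρ|) / (M.rate - ε) + 2) := by
  set j := max (Lam ω) 1 with hj
  cases hT : M.lastExit ε j ω with
  | top => simp
  | coe t =>
    set b := (|Real.log α| + |Real.log M.ρ|) / (M.rate - ε) with hb
    have hr : 0 < M.rate - ε := by linarith
    have hb0 : 0 ≤ b := by positivity
    set n := t + ⌈b⌉₊ with hn
    obtain ⟨i, hi⟩ : ∃ i, j = i + 1 := ⟨j - 1, by omega⟩
    have hnt : |(1 / ((n + 1 : ℕ) : ℝ)) * ∑ l ∈ Finset.Ico j (j + (n + 1)), M.loglik M.greedy l ω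
        - M.pTilde * M.klD.toReal| ≤ ε := by
      by_contra! hc
      have h1 : ((n + 1 : ℕ) : ℕ∞) ≤ M.lastExit ε j ω :=
        le_iSup₂_of_le (n + 1) ⟨by omega, hc⟩ le_rfl
      rw [hT] at h1
      have : n + 1 ≤ t := by exact_mod_cast h1
      omega
    have hn1 : (0 : ℝ) < ((n + 1 : ℕ) : ℝ) := by positivity
    have hsum : ((n + 1 : ℕ) : ℝ) * (M.pTilde * M.klD.toReal - ε) ≤
        ∑ l ∈ Finset.Ico j (j + (n + 1)), M.loglik M.greedy l ω := by
      have h1 := (abs_le.1 hnt).1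
      rw [one_div, ← div_eq_inv_mul] at h1
      have h2 : M.pTilde * M.klD.toReal - ε ≤
          (∑ l ∈ Finset.Ico j (j + (n + 1)), M.loglik M.greedy l ω) / ((n + 1 : ℕ) : ℝ) := by
        linarith
      rw [le_div_iff₀ hn1] at h2
      linarith
    have hlow := M.le_neg_log_notChanged (μ := M.greedy) (j := i) (n := n) (ω := ω)
      (fun l hl => hpos l (by omega))
    rw [← hi] at hlow
    have hbn : b ≤ ((n + 1 : ℕ) : ℝ) := by
      have h1 := Nat.le_ceil b
      have h2 : ((⌈b⌉₊ : ℕ) : ℝ) ≤ ((n + 1 : ℕ) : ℝ) := by exact_mod_cast (by omega)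
      linarith
    have hkey : |Real.log α| ≤ -Real.log (M.notChanged M.greedy (i + n + 1) ω) := by
      have h1 : |Real.log α| + |Real.log M.ρ| ≤ ((n + 1 : ℕ) : ℝ) * (M.rate - ε) := by
        rwa [hb, div_le_iff₀ hr] at hbn
      have h2 := neg_abs_le (Real.log M.ρ)
      have h3 : ((n + 1 : ℕ) : ℝ) * (M.rate - ε) =
          ((n + 1 : ℕ) : ℝ) * (M.pTilde * M.klD.toReal - ε) +
            ((n + 1 : ℕ) : ℝ) * |Real.log (1 - M.ρ)| := by rw [rate]; ring
      linarith
    rw [abs_of_neg (Real.log_neg hα hα1), neg_le_neg_iff] at hkey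
    have hle := (Real.log_le_log_iff (M.notChanged_pos M.greedy _ ω) hα).1 hkey
    have hτ : M.threshold α ω ≤ ((i + n + 1 : ℕ) : ℕ∞) :=
      (M.threshold_le_iff α _ ω).2 ⟨_, le_rfl, by rw [hpost]; linarith⟩
    have hnat : M.threshold α ω - (Lam ω : ℕ∞) ≤ ((n + 1 : ℕ) : ℕ∞) := by
      rw [tsub_le_iff_right]
      refine hτ.trans ?_
      have : i + n + 1 ≤ n + 1 + Lam ω := by omega
      exact_mod_cast this
    have h5 : ((M.threshold α ω - (Lam ω : ℕ∞) : ℕ∞) : ℝ≥0∞) ≤ ((n + 1 : ℕ) : ℝ≥0∞) := by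
      calc _ ≤ ((((n + 1 : ℕ) : ℕ∞)) : ℝ≥0∞) := ENat.toENNReal_le.2 hnat
        _ = _ := by simp
    refine h5.trans ?_
    have h6 : (((n + 1 : ℕ) : ℝ)) ≤ t + (b + 2) := by
      have := (Nat.ceil_lt_add_one hb0).le
      rw [hn]; push_cast; linarith
    calc (((n + 1 : ℕ)) : ℝ≥0∞) = ENNReal.ofReal (((n + 1 : ℕ) : ℝ)) := by
          rw [ENNReal.ofReal_natCast]
      _ ≤ ENNReal.ofReal (t + (b + 2)) := ENNReal.ofReal_le_ofReal h6
      _ = _ := by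
          rw [ENNReal.ofReal_add (Nat.cast_nonneg t) (by linarith), ENNReal.ofReal_natCast]
          simp

end ChangeModel

namespace ChangeModel

variable (M : ChangeModel) {μ : ℕ → Path → Bool} {τ : Path → ℕ∞}

theorem measurable_greedy (k : ℕ) : Measurable (M.greedy k) := by
  cases k with
  | zero => exact measurable_const
  | succ k =>
    exact (M.adapted_greedy.measurable_fullInfo k).mono
      (M.adapted_greedy.fullInfo_le_univ k) le_rfl

theorem measurable_loglik_greedy (k : ℕ) : Measurable (M.loglik M.greedy k) := by
  unfold loglik
  exact Measurable.ite (M.measurable_greedy k (measurableSet_singleton true))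
    (Real.measurable_log.comp (M.measurable_lr.comp (measurable_X k))) measurable_const

theorem measurable_lastExit (ε : ℝ) (j : ℕ) :
    Measurable fun ω => (M.lastExit ε j ω : ℝ≥0∞) := by
  simp only [lastExit, ENat.toENNReal_iSup]
  refine Measurable.iSup fun n => ?_
  have hm : Measurable fun ω => |(1 / (n : ℝ)) * ∑ i ∈ Finset.Ico j (j + n),
      M.loglik M.greedy i ω - M.pTilde * M.klD.toReal| :=
    (((Finset.measurable_fun_sum _ fun i _ => M.measurable_loglik_greedy i).const_mul _).sub_const
      _).abs
  have hs : MeasurableSet {ω | 1 ≤ n ∧ ε < |(1 / (n : ℝ)) * ∑ i ∈ Finset.Ico j (j + n),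
      M.loglik M.greedy i ω - M.pTilde * M.klD.toReal|} :=
    (MeasurableSet.const _).inter (measurableSet_lt measurable_const hm)
  classical
  have : (fun ω => ⨆ (_ : 1 ≤ n ∧ ε < |(1 / (n : ℝ)) * ∑ i ∈ Finset.Ico j (j + n),
      M.loglik M.greedy i ω - M.pTilde * M.klD.toReal|), (((n : ℕ∞)) : ℝ≥0∞)) =
      fun ω => if 1 ≤ n ∧ ε < |(1 / (n : ℝ)) * ∑ i ∈ Finset.Ico j (j + n),
      M.loglik M.greedy i ω - M.pTilde * M.klD.toReal| then (((n : ℕ∞)) : ℝ≥0∞) else 0 := by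
    funext ω
    by_cases h : 1 ≤ n ∧ ε < |(1 / (n : ℝ)) * ∑ i ∈ Finset.Ico j (j + n),
      M.loglik M.greedy i ω - M.pTilde * M.klD.toReal|
    · rw [iSup_pos h, if_pos h]
    · rw [iSup_neg h, if_neg h, bot_eq_zero]
  rw [this]
  exact Measurable.ite hs measurable_const measurable_const

/-- Forget the change point and the value `X_0`, which play no role in the observations. -/
def eraseZero (ω : Path) : Path := (0, fun i => if i = 0 then 0 else ω.2.1 i, ω.2.2)

theorem lastExit_eraseZero (ε : ℝ) {j : ℕ} (hj : 1 ≤ j) (ω : Path) :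
    M.lastExit ε j (eraseZero ω) = M.lastExit ε j ω := by
  have hg : ∀ i, M.greedy i (eraseZero ω) = M.greedy i ω := by
    intro i; cases i <;> rfl
  have hl : ∀ i, 1 ≤ i → M.loglik M.greedy i (eraseZero ω) = M.loglik M.greedy i ω := by
    intro i hi
    have hX : X i (eraseZero ω) = X i ω := by simp [X, eraseZero, Nat.one_le_iff_ne_zero.1 hi]
    rw [loglik, loglik, hg, hX]
  unfold lastExit
  refine iSup_congr fun n => ?_
  rw [Finset.sum_congr rfl fun i hi => hl i (hj.trans (Finset.mem_Ico.1 hi).1)]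

theorem map_eraseZero_condLaw :
    (M.condLaw 0).map eraseZero = (M.condLaw 1).map eraseZero := by
  let f : ℕ → ℝ → ℝ := fun i x => if i = 0 then 0 else x
  have hf : ∀ i, Measurable (f i) := by
    intro i
    by_cases h : i = 0
    · have : f i = fun _ => 0 := by funext x; simp [f, h]
      rw [this]; exact measurable_const
    · have : f i = id := by funext x; simp [f, h]
      rw [this]; exact measurable_id
  have key : ∀ (j : ℕ) (Q : ℕ → Measure ℝ) [∀ i, IsProbabilityMeasure (Q i)],
      (M.pathLaw j Q).map eraseZero = (Measure.dirac 0).prod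
        ((Measure.infinitePi fun i => (Q i).map (f i)).prod
          (Measure.infinitePi fun _ : ℕ => M.p.toMeasure)) := by
    intro j Q _
    have he : eraseZero = Prod.map (fun _ : ℕ => 0)
        (Prod.map (fun (x : ℕ → ℝ) i => f i (x i)) (id : (ℕ → ℕ) → _)) := rfl
    have hm : Measurable fun (x : ℕ → ℝ) i => f i (x i) :=
      measurable_pi_lambda _ fun i => (hf i).comp (measurable_pi_apply i)
    rw [he, pathLaw, ← Measure.map_prod_map _ _ measurable_const
      (hm.prodMap measurable_id), ← Measure.map_prod_map _ _ hm measurable_id,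
      Measure.map_id, Measure.infinitePi_map_pi _ hf, Measure.map_const, measure_univ, one_smul]
  rw [condLaw_eq_pathLaw, condLaw_eq_pathLaw, key, key]
  congr 3
  funext i
  by_cases h : i = 0
  · have : f i = fun _ => 0 := by funext x; simp [f, h]
    rw [this, Measure.map_const, Measure.map_const]
    simp
  · rw [if_neg (by omega), if_neg (by omega)]

theorem lintegral_lastExit_condLaw_zero (ε : ℝ) :
    ∫⁻ ω, (M.lastExit ε 1 ω : ℝ≥0∞) ∂M.condLaw 0 = M.meanLastExit ε 1 := by
  have hm : Measurable eraseZero := by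
    unfold eraseZero
    refine measurable_const.prodMk (Measurable.prodMk (measurable_pi_lambda _ fun i => ?_)
      (by fun_prop))
    by_cases h : i = 0
    · simp [h]
    · simp only [h, if_false]; fun_prop
  have key : ∀ j, ∫⁻ ω, (M.lastExit ε 1 ω : ℝ≥0∞) ∂(M.condLaw j).map eraseZero =
      ∫⁻ ω, (M.lastExit ε 1 ω : ℝ≥0∞) ∂M.condLaw j := by
    intro j
    rw [lintegral_map (M.measurable_lastExit ε 1) hm]
    simp only [M.lastExit_eraseZero ε le_rfl]
  rw [meanLastExit, ← key 0, map_eraseZero_condLaw, key 1]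

theorem condLaw_obsLR_pos (hD : M.klD ≠ ⊤) (j : ℕ) :
    ∀ᵐ ω ∂M.condLaw j, ∀ i, j ≤ i → 0 < M.obsLR (obs M.greedy i ω) := by
  rw [ae_all_iff]
  intro i
  by_cases hij : j ≤ i
  · have h : ∀ᵐ x ∂(M.condLaw j).map (X i), 0 < M.lr x := by
      rw [condLaw_eq_pathLaw, map_X_pathLaw, if_neg (not_lt.2 hij)]
      exact M.law1_lr_pos hD
    filter_upwards [ae_of_ae_map (measurable_X i).aemeasurable h] with ω hω _
    unfold obs
    split_ifs
    · exact hω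
    · simp [obsLR]
  · exact Eventually.of_forall fun ω h => absurd h hij

theorem law_obsLR_pos (hD : M.klD ≠ ⊤) :
    ∀ᵐ ω ∂M.law, ∀ i, max (Lam ω) 1 ≤ i → 0 < M.obsLR (obs M.greedy i ω) := by
  have hc : ∀ j, ∀ᵐ ω ∂M.condLaw j, ∀ i, max (Lam ω) 1 ≤ i →
      0 < M.obsLR (obs M.greedy i ω) := by
    intro j
    filter_upwards [M.condLaw_obsLR_pos hD j, M.Lam_condLaw j] with ω h1 h2 i hi
    exact h1 i (by omega)
  rw [law, Measure.ae_sum_iff]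
  intro j
  exact Measure.ae_smul_measure (hc j) _

/-- The part of the delay bound that does not depend on the false alarm level. -/
theorem lintegral_lastExit_law_ne_top {ε : ℝ} (hquick : M.meanLastExit ε 1 < ⊤)
    (havg : ∑' j : ℕ, M.meanLastExit ε (j + 1) * ENNReal.ofReal (M.prior (j + 1)) < ⊤) :
    ∫⁻ ω, (M.lastExit ε (max (Lam ω) 1) ω : ℝ≥0∞) ∂M.law ≠ ⊤ := by
  have h1 : ∀ j, ∫⁻ ω, (M.lastExit ε (max (Lam ω) 1) ω : ℝ≥0∞) ∂M.condLaw j =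
      ∫⁻ ω, (M.lastExit ε (max j 1) ω : ℝ≥0∞) ∂M.condLaw j := by
    intro j
    refine lintegral_congr_ae ?_
    filter_upwards [M.Lam_condLaw j] with ω hω
    rw [hω]
  rw [lintegral_law, tsum_eq_zero_add' ENNReal.summable]
  simp only [h1]
  refine ENNReal.add_ne_top.2 ⟨ENNReal.mul_ne_top ENNReal.ofReal_ne_top ?_, ?_⟩
  · rw [show max 0 1 = 1 from rfl, lintegral_lastExit_condLaw_zero]
    exact hquick.ne
  · refine ne_of_eq_of_ne (tsum_congr fun j => ?_) havg.ne
    rw [show max (j + 1) 1 = j + 1 by omega, mul_comm, meanLastExit]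

theorem ADD_threshold_le (hD : M.klD ≠ ⊤) {α ε : ℝ} (hα : 0 < α) (hα1 : α < 1)
    (hε : ε < M.rate) :
    M.ADD (M.threshold α) ≤ ∫⁻ ω, (M.lastExit ε (max (Lam ω) 1) ω : ℝ≥0∞) ∂M.law +
      ENNReal.ofReal ((|Real.log α| + |Real.log M.ρ|) / (M.rate - ε) + 2) := by
  have hpost : ∀ᵐ ω ∂M.law, ∀ k,
      M.posterior M.greedy k ω = 1 - M.notChanged M.greedy k ω :=
    ae_all_iff.2 fun k => M.adapted_greedy.posterior_ae_eq M hD k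
  have h1 : ENNReal.ofReal ((|Real.log α| + |Real.log M.ρ|) / (M.rate - ε) + 2) =
      ∫⁻ _, ENNReal.ofReal ((|Real.log α| + |Real.log M.ρ|) / (M.rate - ε) + 2) ∂M.law := by
    simp
  rw [ADD, h1, ← lintegral_add_right _ measurable_const]
  refine lintegral_mono_ae ?_
  filter_upwards [hpost, M.law_obsLR_pos hD] with ω h2 h3
  exact M.threshold_sub_le hα hα1 hε h2 h3

/-! ### Asymptotics -/

theorem tendsto_div_of_bounds {ι : Type*} {F : Filter ι} {l g : ι → ℝ} {q c : ℝ} (hq : 0 < q)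
    (hl : Tendsto l F atTop) (hlow : ∀ᶠ a in F, (l a - c) / q ≤ g a)
    (hup : ∀ ε, 0 < ε → ε < q → ∃ C, ∀ᶠ a in F, g a ≤ C + l a / (q - ε)) :
    Tendsto (fun a => g a / (l a / q)) F (𝓝 1) := by
  have hinv : ∀ c : ℝ, Tendsto (fun a => c / l a) F (𝓝 0) := fun c => hl.const_div_atTop c
  rw [tendsto_order]
  constructor
  · intro b hb
    have h1 : Tendsto (fun a => 1 - c / l a) F (𝓝 1) := by simpa using (hinv c).const_sub 1
    filter_upwards [hlow, hl.eventually_gt_atTop 0, h1.eventually_const_lt hb] with a h2 h3 h4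
    refine h4.trans_le ?_
    rw [le_div_iff₀ (div_pos h3 hq)]
    refine le_trans (le_of_eq ?_) h2
    field_simp
  · intro b hb
    obtain ⟨C, hC⟩ := hup (q * (1 - 2 / (1 + b)))
      (mul_pos hq (by rw [sub_pos, div_lt_one (by linarith)]; linarith))
      (mul_lt_of_lt_one_right hq (by
        have : 0 < 2 / (1 + b) := by positivity
        linarith))
    have hqe : q - q * (1 - 2 / (1 + b)) = 2 * q / (1 + b) := by ring
    rw [hqe] at hC
    have h1 : Tendsto (fun a => C * q / l a + (1 + b) / 2) F (𝓝 ((1 + b) / 2)) := by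
      simpa using (hinv (C * q)).add_const ((1 + b) / 2)
    filter_upwards [hC, hl.eventually_gt_atTop 0,
      h1.eventually_lt_const (by linarith : (1 + b) / 2 < b)] with a h2 h3 h4
    refine lt_of_le_of_lt ?_ h4
    rw [div_le_iff₀ (div_pos h3 hq)]
    refine h2.trans (le_of_eq ?_)
    have : (1 + b) ≠ 0 := by linarith
    field_simp

theorem ofReal_rate (hD : M.klD ≠ ⊤) :
    ENNReal.ofReal |Real.log (1 - M.ρ)| + M.klD * ENNReal.ofReal M.chainLimit =
      ENNReal.ofReal M.rate := by
  rw [rate, pTilde_eq, ENNReal.ofReal_add (mul_nonneg M.chainLimit_nonneg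
    ENNReal.toReal_nonneg) (abs_nonneg _), ENNReal.ofReal_mul M.chainLimit_nonneg,
    ENNReal.ofReal_toReal hD, add_comm, mul_comm]

theorem le_optADD (hD : M.klD ≠ ⊤) {α : ℝ} (hα : 0 < α) (hα1 : α < 1) :
    (ENNReal.ofReal |Real.log α| - M.delayConst) / ENNReal.ofReal M.rate ≤ M.optADD α := by
  refine le_iInf₂ fun μ τ => le_iInf₂ fun hμ hτ => le_iInf fun hPFA => ?_
  by_cases hADD : M.ADD τ = ⊤
  · rw [hADD]; exact le_top
  · have h := hμ.ofReal_abs_log_le hD hτ hα hα1 hPFA hADD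
    rw [M.ofReal_rate hD] at h
    refine ENNReal.div_le_of_le_mul ?_
    rw [tsub_le_iff_left]
    exact h

theorem optADD_le_ADD_threshold (hD : M.klD ≠ ⊤) (α : ℝ) :
    M.optADD α ≤ M.ADD (M.threshold α) :=
  iInf₂_le_of_le M.greedy (M.threshold α) (iInf₂_le_of_le M.admissible_greedy
    (M.isStopping_threshold α) (iInf_le_of_le (M.PFA_threshold_le hD α) le_rfl))

end ChangeModel

end

theorem theorem6 (M : ChangeModel) (hD : M.klD ≠ ⊤)
    (hquick : ∀ ε : ℝ, 0 < ε → ∀ j : ℕ, 1 ≤ j → M.meanLastExit ε j < ⊤)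
    (havg : ∀ ε : ℝ, 0 < ε →
      ∑' j : ℕ, M.meanLastExit ε (j + 1) * ENNReal.ofReal (M.prior (j + 1)) < ⊤) :
    -- the limit that defines the long-run sampling probability exists
    Tendsto M.greedyProb atTop (𝓝 M.pTilde) ∧
    -- the proposed pair is feasible
    M.Admissible M.greedy ∧
    (∀ α : ℝ, 0 < α → α < 1 → ChangeModel.IsStopping M.greedy (M.threshold α) ∧
      M.PFA (M.threshold α) ≤ ENNReal.ofReal α) ∧
    -- its delay is asymptotic to the first-order expression
    Tendsto (fun α : ℝ => M.ADD (M.threshold α) / ENNReal.ofReal (M.firstOrder α))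
      (𝓝[>] 0) (𝓝 1) ∧
    -- its delay is asymptotic to the least possible delay at the same false alarm level
    Tendsto (fun α : ℝ => M.ADD (M.threshold α) / M.optADD α) (𝓝[>] 0) (𝓝 1) := by
  have hq := M.rate_pos
  have hmem : ∀ᶠ α : ℝ in 𝓝[>] 0, 0 < α ∧ α < 1 := Ioo_mem_nhdsGT one_pos
  have hl : Tendsto (fun α : ℝ => |Real.log α|) (𝓝[>] 0) atTop :=
    tendsto_abs_atBot_atTop.comp Real.tendsto_log_nhdsGT_zero
  have hfin : ∀ α : ℝ, 0 < α → α < 1 → M.ADD (M.threshold α) ≠ ⊤ := by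
    intro α hα hα1
    refine ne_top_of_le_ne_top ?_ (M.ADD_threshold_le hD hα hα1 (half_lt_self hq))
    exact ENNReal.add_ne_top.2 ⟨M.lintegral_lastExit_law_ne_top
      (hquick _ (half_pos hq) 1 le_rfl) (havg _ (half_pos hq)), ENNReal.ofReal_ne_top⟩
  have hlow : ∀ α : ℝ, 0 < α → α < 1 →
      (|Real.log α| - M.delayConst.toReal) / M.rate ≤ (M.optADD α).toReal := by
    intro α hα hα1
    have h1 := M.le_optADD hD hα hα1
    have h2 : M.optADD α ≠ ⊤ :=
      ne_top_of_le_ne_top (hfin α hα hα1) (M.optADD_le_ADD_threshold hD α)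
    have h3 := ENNReal.toReal_mono h2 h1
    refine le_trans ?_ h3
    rw [ENNReal.toReal_div, ENNReal.toReal_ofReal hq.le]
    gcongr
    have h4 := ENNReal.le_toReal_sub (a := ENNReal.ofReal |Real.log α|) (M.delayConst_ne_top hD)
    rwa [ENNReal.toReal_ofReal (abs_nonneg _)] at h4
  have hle : ∀ α : ℝ, 0 < α → α < 1 →
      (M.optADD α).toReal ≤ (M.ADD (M.threshold α)).toReal := fun α hα hα1 =>
    ENNReal.toReal_mono (hfin α hα hα1) (M.optADD_le_ADD_threshold hD α)
  have hup : ∀ ε, 0 < ε → ε < M.rate → ∃ C, ∀ᶠ α : ℝ in 𝓝[>] 0,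
      (M.ADD (M.threshold α)).toReal ≤ C + |Real.log α| / (M.rate - ε) := by
    intro ε hε hεq
    have hT := M.lintegral_lastExit_law_ne_top (hquick ε hε 1 le_rfl) (havg ε hε)
    refine ⟨(∫⁻ ω, (M.lastExit ε (max (ChangeModel.Lam ω) 1) ω : ℝ≥0∞) ∂M.law).toReal +
      |Real.log M.ρ| / (M.rate - ε) + 2, ?_⟩
    filter_upwards [hmem] with α hα
    have h1 := ENNReal.toReal_mono (ENNReal.add_ne_top.2 ⟨hT, ENNReal.ofReal_ne_top⟩)
      (M.ADD_threshold_le hD hα.1 hα.2 hεq)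
    have h2 : 0 < M.rate - ε := by linarith
    rw [ENNReal.toReal_add hT ENNReal.ofReal_ne_top,
      ENNReal.toReal_ofReal (by positivity), add_div] at h1
    linarith
  have hratioADD : Tendsto (fun α : ℝ => (M.ADD (M.threshold α)).toReal /
      (|Real.log α| / M.rate)) (𝓝[>] 0) (𝓝 1) := by
    refine ChangeModel.tendsto_div_of_bounds (c := M.delayConst.toReal) hq hl ?_ hup
    filter_upwards [hmem] with α hα
    exact (hlow α hα.1 hα.2).trans (hle α hα.1 hα.2)
  have hratioOpt : Tendsto (fun α : ℝ => (M.optADD α).toReal /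
      (|Real.log α| / M.rate)) (𝓝[>] 0) (𝓝 1) := by
    refine ChangeModel.tendsto_div_of_bounds (c := M.delayConst.toReal) hq hl ?_
      fun ε hε hεq => ?_
    · filter_upwards [hmem] with α hα
      exact hlow α hα.1 hα.2
    · obtain ⟨C, hC⟩ := hup ε hε hεq
      refine ⟨C, ?_⟩
      filter_upwards [hmem, hC] with α hα h
      exact (hle α hα.1 hα.2).trans h
  refine ⟨?_, M.admissible_greedy, fun α _ _ =>
    ⟨M.isStopping_threshold α, M.PFA_threshold_le hD α⟩, ?_, ?_⟩
  · rw [ChangeModel.pTilde_eq]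
    exact M.tendsto_greedyProb_chainLimit
  · have h := ENNReal.tendsto_ofReal hratioADD
    rw [ENNReal.ofReal_one] at h
    refine h.congr' ?_
    filter_upwards [hmem, hl.eventually_gt_atTop 0] with α hα hlog
    rw [ENNReal.ofReal_div_of_pos (div_pos hlog hq), ENNReal.ofReal_toReal (hfin α hα.1 hα.2)]
    rfl
  · have h := ENNReal.tendsto_ofReal (hratioADD.div hratioOpt one_ne_zero)
    rw [div_one, ENNReal.ofReal_one] at h
    refine h.congr' ?_
    filter_upwards [hmem, hl.eventually_gt_atTop (max 0 M.delayConst.toReal)] with α hα hlog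
    have hl0 : 0 < |Real.log α| := (le_max_left _ _).trans_lt hlog
    have hopt : 0 < (M.optADD α).toReal :=
      lt_of_lt_of_le (div_pos (sub_pos.2 ((le_max_right _ _).trans_lt hlog)) hq)
        (hlow α hα.1 hα.2)
    have hopt_top : M.optADD α ≠ ⊤ := fun h => by simp [h] at hopt
    simp only [Pi.div_apply]
    rw [div_div_div_cancel_right₀ (div_pos hl0 hq).ne', ENNReal.ofReal_div_of_pos hopt,
      ENNReal.ofReal_toReal (hfin α hα.1 hα.2), ENNReal.ofReal_toReal hopt_top]
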